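/- \textbf{Setting.} Let $\mathcal L=\{(n,i,j)\in\mathbb Z^3 : n\equiv i+j \pmod 2\}$. Call $(i_1,j_1),(i_2,j_2)\in\mathbb Z^2$ lattice-adjacent if $|i_1-i_2|+|j_1-j_2|=1$. A function $h:\mathbb Z^2\to\mathbb Z$ is a \emph{height function} if $|h(f)-h(g)|=1$ for lattice-adjacent $f,g$, if $(h(i,j),i,j)\in\mathcal L$ for all $i,j$, and if $h(i,j)+|i|+|j|\to\infty$ as $|i|+|j|\to\infty$. Put $\mathcal I=\{(n,i,j)\in\mathcal L: n=h(i,j)\}$ and $\mathcal U=\{(n,i,j)\in\mathcal L: n>h(i,j)\}$. The infinite \emph{crosses-and-wrenches graph} $\mathcal G$ of $h$ is the planar graph with one face for each point of $\mathbb Z^2$, in which two faces share an edge (exactly one) if and only if they are lattice-adjacent, or they are $(i_1,j_1),(i_2,j_2)$ with $|i_1-i_2|=|j_1-j_2|=1$ and $h(i_1,j_2)\ne h(i_2,j_1)$. Thus each unit square with corners in $\mathbb Z^2$ contains one vertex of $\mathcal G$, lying on all four faces at the corners (a cross), if neither diagonal pair of corners borders; otherwise exactly one diagonal pair borders and the square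 contains two vertices, each lying on the two faces of that pair and on one of the other two faces (a wrench). The edge separating two bordering faces joins the two vertices lying on both of them. For $(n_0,i_0,j_0)\in\mathcal I\cup\mathcal U$ call a face $(i,j)$ \emph{closed} if $h(i,j)<n_0-|i-i_0|-|j-j_0|$, and let $G_{(n_0,i_0,j_0)}$ be the subgraph of $\mathcal G$ formed by all edges bordering at least one closed face and the endpoints of these edges (the empty graph if $(n_0,i_0,j_0)\in\mathcal I$). A \emph{matching} of a graph is a set of its edges such that each vertex lies on exactly one edge of the set; write $N(n,i,j)$ for the number of matchings of $G_{(n,i,j)}$ (so the empty graph has exactly one matching). \textbf{Statement.} Each of the three functions $h$ below is a height function. For each of them, $N$ satisfies $N(n,i,j)=1$ on $\mathcal I$ and the octahedron recurrence $$N(n,i,j)\,N(n-2,i,j)=N(n-1,i,j+1)\,N(n-1,i,j-1)+N(n-1,i+1,j)\,N(n-1,i-1,j)$$ on $\mathcal U$. Moreover $N$ is given by the following formulas, for all $n,i,j\in\mathbb Z$ such that the argument of $N$ lies in $\mathcal I\cup\mathcal U$. (1) \emph{Fortresses.} $h(i,j)=0$ if $i+j$ is even, $h(i,j)=1$ if $i$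 is even and $j$ is odd, $h(i,j)=-1$ if $i$ is odd and $j$ is even. Then $N(2n,i,j)=5^{n^2}$, while $N(2n+1,i,j)=5^{n^2+n}$ if $i\equiv n\pmod 2$ and $N(2n+1,i,j)=2\cdot 5^{n^2+n}$ if $j\equiv n\pmod 2$. (2) \emph{Douglass' graphs.} $h(i,j)=0$ if $i+j$ is even, $h(i,j)=1$ if $i+j\equiv 1\pmod 4$, $h(i,j)=-1$ if $i+j\equiv -1\pmod 4$. Then $N(2n,i,j)=2^{2n^2}$, while $N(2n+1,i,j)=2^{2n^2+2n}$ if $i+j\equiv 2n+1\pmod 4$ and $N(2n+1,i,j)=2^{2n^2+2n+1}$ if $i+j\equiv 2n-1\pmod 4$. (3) \emph{Blum's graphs.} $h(i,j)=0$ if $i+j$ is even; for $i+j$ odd, $h(i,j)=1$ if $j\equiv 0,1\pmod 4$ and $h(i,j)=-1$ if $j\equiv 2,3\pmod 4$. Then $N(3n,i,j)=3^{3n^2}$, and for either choice of the sign (the same throughout) $N(3n\pm1,i,j)=3^{3n^2\pm 2n}$ if $\lfloor (3n\pm1)/3\rfloor+\lfloor j/2\rfloor$ is even and $N(3n\pm1,i,j)=2\cdot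 3^{3n^2\pm 2n}$ if it is odd. -/

import Mathlib

/-- The lattice of triples `(n, i, j)` of integers with `n ≡ i + j (mod 2)`. -/
def octLattice : Set (ℤ × ℤ × ℤ) :=
  {t | t.1 ≡ t.2.1 + t.2.2 [ZMOD 2]}

/-- `p_{(n₀,i₀,j₀)}(i,j) = n₀ - |i - i₀| - |j - j₀|`. -/
def coneHeight (n₀ i₀ j₀ i j : ℤ) : ℤ :=
  n₀ - |i - i₀| - |j - j₀|

/-- Two faces `f, g ∈ ℤ²` are lattice-adjacent if `|i₁ - i₂| + |j₁ - j₂| = 1`. -/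
def LatticeAdjacent (f g : ℤ × ℤ) : Prop :=
  |f.1 - g.1| + |f.2 - g.2| = 1

/-- Height functions. The last field is `h(i,j) + |i| + |j| → ∞` as `|i| + |j| → ∞`. -/
structure IsHeightFunction (h : ℤ → ℤ → ℤ) : Prop where
  step : ∀ f g : ℤ × ℤ, LatticeAdjacent f g → |h f.1 f.2 - h g.1 g.2| = 1
  mem_lattice : ∀ i j : ℤ, (h i j, i, j) ∈ octLattice
  tendsto : ∀ B : ℤ, ∃ R : ℤ, ∀ i j : ℤ, R ≤ |i| + |j| → B ≤ h i j + |i| + |j|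

/-- The initial surface `ℐ` of `h`. -/
def initialSet (h : ℤ → ℤ → ℤ) : Set (ℤ × ℤ × ℤ) :=
  {t | t ∈ octLattice ∧ t.1 = h t.2.1 t.2.2}

/-- The part `𝒰` of the lattice strictly above the initial surface. -/
def upperSet (h : ℤ → ℤ → ℤ) : Set (ℤ × ℤ × ℤ) :=
  {t | t ∈ octLattice ∧ h t.2.1 t.2.2 < t.1}

/-- The octahedron recurrence above the surface of `h`, all face and edge variables being
specialised to `1`: `f = 1` on the initial surface, and
`f(n,i,j) f(n-2,i,j) = f(n-1,i,j+1) f(n-1,i,j-1) + f(n-1,i+1,j) f(n-1,i-1,j)` above it. -/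
def SatisfiesOctahedronRecurrence (h : ℤ → ℤ → ℤ) (f : ℤ → ℤ → ℤ → ℕ) : Prop :=
  (∀ n i j : ℤ, (n, i, j) ∈ initialSet h → f n i j = 1) ∧
  (∀ n i j : ℤ, (n, i, j) ∈ upperSet h →
    f n i j * f (n - 2) i j =
      f (n - 1) i (j + 1) * f (n - 1) i (j - 1) + f (n - 1) (i + 1) j * f (n - 1) (i - 1) j)

/-- Bordering of faces in the infinite crosses-and-wrenches graph: lattice-adjacent faces
always border; diagonally neighbouring faces `(i₁,j₁)`, `(i₂,j₂)` border if and only if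
`h(i₁,j₂) ≠ h(i₂,j₁)`. No other faces border. -/
def FacesBorder (h : ℤ → ℤ → ℤ) (f g : ℤ × ℤ) : Prop :=
  LatticeAdjacent f g ∨
    (|f.1 - g.1| = 1 ∧ |f.2 - g.2| = 1 ∧ h f.1 g.2 ≠ h g.1 f.2)

/-- A vertex of the infinite graph is recorded as the set of the faces around it. In the unit
square with corners `(i,j)`, `(i+1,j)`, `(i,j+1)`, `(i+1,j+1)` there is

* a cross (one vertex, surrounded by all four faces) if neither diagonal pair borders;
* a wrench (two vertices, each surrounded by the two faces of the bordering diagonal pair and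
  one of the two other faces) if one of the diagonal pairs borders. -/
def IsGraphVertex (h : ℤ → ℤ → ℤ) (v : Finset (ℤ × ℤ)) : Prop :=
  ∃ i j : ℤ,
    (h i j = h (i + 1) (j + 1) ∧ h (i + 1) j = h i (j + 1) ∧
      v = {(i, j), (i + 1, j), (i, j + 1), (i + 1, j + 1)}) ∨
    (h (i + 1) j ≠ h i (j + 1) ∧
      (v = {(i, j), (i + 1, j + 1), (i + 1, j)} ∨
        v = {(i, j), (i + 1, j + 1), (i, j + 1)})) ∨
    (h i j ≠ h (i + 1) (j + 1) ∧
      (v = {(i + 1, j), (i, j + 1), (i, j)} ∨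
        v = {(i + 1, j), (i, j + 1), (i + 1, j + 1)}))

/-- The vertices of the infinite crosses-and-wrenches graph of `h`. -/
def GraphVertex (h : ℤ → ℤ → ℤ) : Type :=
  {v : Finset (ℤ × ℤ) // IsGraphVertex h v}

/-- `u` and `v` are the two ends of the edge separating the bordering faces `f` and `g`. -/
def EdgeSeparates (h : ℤ → ℤ → ℤ) (u v : GraphVertex h) (f g : ℤ × ℤ) : Prop :=
  u ≠ v ∧ FacesBorder h f g ∧ f ∈ u.1 ∧ g ∈ u.1 ∧ f ∈ v.1 ∧ g ∈ v.1

theorem EdgeSeparates.symm {h : ℤ → ℤ → ℤ} {u v : GraphVertex h} {f g : ℤ × ℤ}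
    (H : EdgeSeparates h u v f g) : EdgeSeparates h v u f g :=
  ⟨H.1.symm, H.2.1, H.2.2.2.2.1, H.2.2.2.2.2, H.2.2.1, H.2.2.2.1⟩

/-- The infinite crosses-and-wrenches graph `𝒢` of `h`: one edge for each unordered pair of
bordering faces, joining the two vertices that lie on both faces. -/
def infiniteGraph (h : ℤ → ℤ → ℤ) : SimpleGraph (GraphVertex h) where
  Adj u v := ∃ f g : ℤ × ℤ, EdgeSeparates h u v f g
  symm := ⟨fun _ _ ⟨f, g, H⟩ => ⟨f, g, H.symm⟩⟩
  loopless := ⟨fun _ ⟨_, _, H⟩ => H.1 rfl⟩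

/-- The face `f` is a closed face of `G_{(n₀,i₀,j₀)}`: the point of the initial surface over `f`
lies in the inner cone of `(n₀,i₀,j₀)`. -/
def IsClosedFace (h : ℤ → ℤ → ℤ) (n₀ i₀ j₀ : ℤ) (f : ℤ × ℤ) : Prop :=
  h f.1 f.2 < coneHeight n₀ i₀ j₀ f.1 f.2

/-- The crosses-and-wrenches graph `G_{(n₀,i₀,j₀)}`: its edges are the edges of the infinite graph
that border a closed face, and its vertices are the ends of these edges. -/
def crossesWrenchesGraph (h : ℤ → ℤ → ℤ) (n₀ i₀ j₀ : ℤ) : (infiniteGraph h).Subgraph where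
  verts := {v | ∃ u : GraphVertex h, ∃ f g : ℤ × ℤ,
    EdgeSeparates h v u f g ∧ (IsClosedFace h n₀ i₀ j₀ f ∨ IsClosedFace h n₀ i₀ j₀ g)}
  Adj v u := ∃ f g : ℤ × ℤ,
    EdgeSeparates h v u f g ∧ (IsClosedFace h n₀ i₀ j₀ f ∨ IsClosedFace h n₀ i₀ j₀ g)
  adj_sub := fun ⟨f, g, H, _⟩ => ⟨f, g, H⟩
  edge_vert := fun {_ u} H => ⟨u, H⟩
  symm := ⟨fun _ _ ⟨f, g, H, hc⟩ => ⟨f, g, H.symm, hc⟩⟩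

/-- The number of (perfect) matchings of `G_{(n₀,i₀,j₀)}`: subgraphs `M` of it in which each of
the vertices of `G_{(n₀,i₀,j₀)}` has exactly one neighbour. -/
noncomputable def matchingCount (h : ℤ → ℤ → ℤ) (n₀ i₀ j₀ : ℤ) : ℕ :=
  Set.ncard {M : (infiniteGraph h).Subgraph |
    M ≤ crossesWrenchesGraph h n₀ i₀ j₀ ∧ M.IsMatching ∧
      M.verts = (crossesWrenchesGraph h n₀ i₀ j₀).verts}

/-- The height function of the fortress graphs. -/
def fortressHeight (i j : ℤ) : ℤ :=
  if (i + j) % 2 = 0 then 0 else if i % 2 = 0 then 1 else -1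

/-- The height function of Douglass' graphs. -/
def douglassHeight (i j : ℤ) : ℤ :=
  if (i + j) % 2 = 0 then 0 else if (i + j) % 4 = 1 then 1 else -1

/-- The height function of Blum's graphs. -/
def blumHeight (i j : ℤ) : ℤ :=
  if (i + j) % 2 = 0 then 0 else if j % 4 = 0 ∨ j % 4 = 1 then 1 else -1

/-! The octahedron recurrence is never derived directly for matchings. Instead, `matchingCount_eq`
shows that the matching numbers agree with any nowhere vanishing rational solution `f` of the
recurrence that equals `1` on the initial surface. Each family then only needs one explicit
solution, from which both its closed formula and its recurrence follow.

To prove `matchingCount_eq`, replace `h` by its minimum with the cone below the apex (`completion`).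
A matching of the finite graph is recorded by its edges dual to lattice segments, since an edge
inside a wrench is matched exactly when no side of its square is. By `matchingCount_eq_card` these
records are the finite sets of segments that are valid for the completed surface;
`exists_closed_of_mem` shows that such a set contains no segment with both ends outside the closed
region. A set is weighted by the product over faces of the face variable to the power (half the
number of edges) - 1 - (number of matched edges).

The engine is urban renewal (`partitionSum_raiseAt`): raising the surface by `2` at a strict local
minimum, and changing the variable there by the octahedron recurrence, preserves the weighted sum.
With the other segments fixed, this is a finite identity in the four segments at that face
(`renewal_local_sum`). Repeated raising turns the completed surface into the cone, whose only valid
set is empty, with weight the apex variable (`partitionSum_cone`). Taking the values of `f` as face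
variables, the original sum is therefore `f n₀ i₀ j₀` (`partitionSum_completion`). If `f = 1` on the
surface of `h`, every weight is `1` and the sum is a count.

The explicit solutions are powers of 5, 2 or 3 times a coefficient 1 or 2. They work because 1·2 =
2, 1² + 2² = 5 and 2 + t² = 3t for t = 1, 2. -/

/-! ### Matchings encoded by lattice segments, and their weights. -/

/-- Indicator function of a set of lattice segments; `(false, i, j)` codes the segment from `(i, j)`
to `(i + 1, j)` and `(true, i, j)` the one from `(i, j)` to `(i, j + 1)`. -/
def segInd (S : Finset (Bool × ℤ × ℤ)) (k : Bool) (i j : ℤ) : ℤ :=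
  if (k, i, j) ∈ S then 1 else 0

/-- The matching condition at the vertices inside the unit square with lower left corner `(i, j)`,
for the surface `g`, in terms of the indicators `a` and `b` of the horizontal and vertical segments
whose dual edges are matched. -/
def SquareValid (g a b : ℤ → ℤ → ℤ) (i j : ℤ) : Prop :=
  (g i j = g (i + 1) (j + 1) ∧ g (i + 1) j = g i (j + 1) →
    a i j + a i (j + 1) + b i j + b (i + 1) j = 1) ∧
  (g (i + 1) j ≠ g i (j + 1) →
    a i j + b (i + 1) j = a i (j + 1) + b i j ∧ a i j + b (i + 1) j ≤ 1) ∧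
  (g i j ≠ g (i + 1) (j + 1) →
    a i j + b i j = a i (j + 1) + b (i + 1) j ∧ a i j + b i j ≤ 1)

/-- Indicator of the edge separating `(i, j)` and `(i + 1, j + 1)`. -/
def mainWrench (g : ℤ → ℤ → ℤ) (i j : ℤ) : ℤ :=
  if g (i + 1) j = g i (j + 1) then 0 else 1

/-- Indicator of the edge separating `(i + 1, j)` and `(i, j + 1)`. -/
def antiWrench (g : ℤ → ℤ → ℤ) (i j : ℤ) : ℤ :=
  if g i j = g (i + 1) (j + 1) then 0 else 1

/-- Indicator of the edge separating `(i, j)` and `(i + 1, j + 1)` being matched. -/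
def mainMatched (g a b : ℤ → ℤ → ℤ) (i j : ℤ) : ℤ :=
  if g (i + 1) j = g i (j + 1) then 0 else 1 - (a i j + b (i + 1) j)

/-- Indicator of the edge separating `(i + 1, j)` and `(i, j + 1)` being matched. -/
def antiMatched (g a b : ℤ → ℤ → ℤ) (i j : ℤ) : ℤ :=
  if g i j = g (i + 1) (j + 1) then 0 else 1 - (a i j + b i j)

/-- Half the number of edges of the face `(i, j)`, minus one, minus the number of its matched
edges. -/
def faceExponent (g a b : ℤ → ℤ → ℤ) (i j : ℤ) : ℤ :=
  (4 + mainWrench g i j + mainWrench g (i - 1) (j - 1) + antiWrench g (i - 1) j +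
      antiWrench g i (j - 1)) / 2 - 1
    - (a i j + a (i - 1) j + b i j + b i (j - 1) + mainMatched g a b i j +
      mainMatched g a b (i - 1) (j - 1) + antiMatched g a b (i - 1) j +
      antiMatched g a b i (j - 1))

open Classical in
/-- The weight of a set of segments. -/
noncomputable def segWeight (g : ℤ → ℤ → ℤ) (x : ℤ → ℤ → ℚ) (F : Finset (ℤ × ℤ))
    (a b : ℤ → ℤ → ℤ) : ℚ :=
  if ∀ i j, SquareValid g a b i j then ∏ f ∈ F, x f.1 f.2 ^ faceExponent g a b f.1 f.2 else 0

/-- The weighted sum over all matchings with matched segments in `E`. -/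
noncomputable def partitionSum (g : ℤ → ℤ → ℤ) (x : ℤ → ℤ → ℚ) (E : Finset (Bool × ℤ × ℤ))
    (F : Finset (ℤ × ℤ)) : ℚ :=
  ∑ S ∈ E.powerset, segWeight g x F (segInd S false) (segInd S true)

/-- `g` raised by `2` at `(i, j)`. -/
def raiseAt (g : ℤ → ℤ → ℤ) (i j : ℤ) : ℤ → ℤ → ℤ :=
  fun p q => if p = i ∧ q = j then g i j + 2 else g p q

/-! ### Urban renewal: the local identity and the locality of weights. -/

/-- Here `e n w s` are the four segments at the raised face, and `c₁ … c₄` the numbers of them that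
the surroundings require in the four adjacent squares. Raising exchanges crosses and wrenches there,
so each requirement `c` becomes `1 - c`. The requirements are solvable only if `c₁ + c₃ = c₂ + c₄`.
A single matched segment passes to the opposite side with unchanged weight, while an empty
configuration is exchanged with the two configurations formed by opposite segments; this last
exchange is the recurrence. -/
theorem renewal_local_sum {xf xf' xe xn xw xs : ℚ} (hf : xf ≠ 0) (hf' : xf' ≠ 0) (he : xe ≠ 0)
    (hn : xn ≠ 0) (hw : xw ≠ 0) (hs : xs ≠ 0) (hx : xf' * xf = xn * xs + xe * xw)
    {c₁ c₂ c₃ c₄ : ℤ} (h₁ : c₁ = 0 ∨ c₁ = 1) (h₂ : c₂ = 0 ∨ c₂ = 1) (h₃ : c₃ = 0 ∨ c₃ = 1)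
    (h₄ : c₄ = 0 ∨ c₄ = 1) (Ae An Aw As : ℤ) :
    (∑ e : Bool, ∑ n : Bool, ∑ w : Bool, ∑ s : Bool,
      if (e.toInt + n.toInt = c₁ ∧ n.toInt + w.toInt = c₂ ∧ w.toInt + s.toInt = c₃ ∧
        s.toInt + e.toInt = c₄) then
        xf ^ (1 - e.toInt - n.toInt - w.toInt - s.toInt) * (xe ^ (Ae - e.toInt) *
          xn ^ (An - n.toInt) * xw ^ (Aw - w.toInt) * xs ^ (As - s.toInt)) else 0) =
    (∑ e : Bool, ∑ n : Bool, ∑ w : Bool, ∑ s : Bool,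
      if (e.toInt + n.toInt = 1 - c₁ ∧ n.toInt + w.toInt = 1 - c₂ ∧ w.toInt + s.toInt = 1 - c₃ ∧
        s.toInt + e.toInt = 1 - c₄) then
        xf' ^ (1 - e.toInt - n.toInt - w.toInt - s.toInt) * (xe ^ (Ae + 1 - c₁ - c₄ - e.toInt) *
          xn ^ (An + 1 - c₁ - c₂ - n.toInt) * xw ^ (Aw + 1 - c₂ - c₃ - w.toInt) *
          xs ^ (As + 1 - c₃ - c₄ - s.toInt)) else 0) := by
  have hz : (-1 : ℤ) + 1 = 0 := by norm_num
  rcases h₁ with rfl | rfl <;> rcases h₂ with rfl | rfl <;> rcases h₃ with rfl | rfl <;>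
    rcases h₄ with rfl | rfl <;>
    simp [Bool.toInt, zpow_sub₀, zpow_add₀, he, hn, hw, hs]
  -- Only the case where all `c` are 0 (here) and the case where all are 1 (next) use the
  -- recurrence; `simp` has settled the other fourteen.
  · field_simp
    linear_combination hx
  · field_simp
    linear_combination -hx

/-- The surfaces `g₂`, `g` agree off the face `(i, j)` and the indicators `a`, `A` and `b`, `B` agree
off the four segments at `(i, j)`. -/
structure AgreesOff (i j : ℤ) (g₂ g a A b B : ℤ → ℤ → ℤ) : Prop where
  surface : ∀ p q, (p = i ∧ q = j) ∨ g₂ p q = g p q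
  horiz : ∀ p q, (p = i ∧ q = j) ∨ (p = i - 1 ∧ q = j) ∨ a p q = A p q
  vert : ∀ p q, (p = i ∧ q = j) ∨ (p = i ∧ q = j - 1) ∨ b p q = B p q

namespace AgreesOff

variable {i j : ℤ} {g₂ g a A b B : ℤ → ℤ → ℤ}

theorem mainWrench_eq (H : AgreesOff i j g₂ g a A b B) (p q : ℤ)
    (h₁ : ¬ (p + 1 = i ∧ q = j)) (h₂ : ¬ (p = i ∧ q + 1 = j)) :
    mainWrench g₂ p q = mainWrench g p q := by
  unfold mainWrench
  rw [(H.surface (p + 1) q).resolve_left h₁, (H.surface p (q + 1)).resolve_left h₂]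

theorem antiWrench_eq (H : AgreesOff i j g₂ g a A b B) (p q : ℤ)
    (h₁ : ¬ (p = i ∧ q = j)) (h₂ : ¬ (p + 1 = i ∧ q + 1 = j)) :
    antiWrench g₂ p q = antiWrench g p q := by
  unfold antiWrench
  rw [(H.surface p q).resolve_left h₁, (H.surface (p + 1) (q + 1)).resolve_left h₂]

/-- The square at `(p, q)` does not have `(i, j)` as a corner. -/
def FarSquare (i j p q : ℤ) : Prop :=
  ¬ ((p = i ∨ p = i - 1) ∧ (q = j ∨ q = j - 1))

theorem squareValid_iff (H : AgreesOff i j g₂ g a A b B) (p q : ℤ) (h : FarSquare i j p q) :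
    SquareValid g₂ a b p q ↔ SquareValid g A B p q := by
  unfold FarSquare at h
  unfold SquareValid
  rw [(H.surface p q).resolve_left (by omega), (H.surface (p + 1) (q + 1)).resolve_left (by omega),
    (H.surface (p + 1) q).resolve_left (by omega), (H.surface p (q + 1)).resolve_left (by omega),
    ((H.horiz p q).resolve_left (by omega)).resolve_left (by omega),
    ((H.horiz p (q + 1)).resolve_left (by omega)).resolve_left (by omega),
    ((H.vert p q).resolve_left (by omega)).resolve_left (by omega),
    ((H.vert (p + 1) q).resolve_left (by omega)).resolve_left (by omega)]

theorem mainMatched_eq (H : AgreesOff i j g₂ g a A b B) (p q : ℤ) (h : FarSquare i j p q) :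
    mainMatched g₂ a b p q = mainMatched g A B p q := by
  unfold FarSquare at h
  unfold mainMatched
  rw [(H.surface (p + 1) q).resolve_left (by omega), (H.surface p (q + 1)).resolve_left (by omega),
    ((H.horiz p q).resolve_left (by omega)).resolve_left (by omega),
    ((H.vert (p + 1) q).resolve_left (by omega)).resolve_left (by omega)]

theorem antiMatched_eq (H : AgreesOff i j g₂ g a A b B) (p q : ℤ) (h : FarSquare i j p q) :
    antiMatched g₂ a b p q = antiMatched g A B p q := by
  unfold FarSquare at h
  unfold antiMatched
  rw [(H.surface p q).resolve_left (by omega), (H.surface (p + 1) (q + 1)).resolve_left (by omega),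
    ((H.horiz p q).resolve_left (by omega)).resolve_left (by omega),
    ((H.vert p q).resolve_left (by omega)).resolve_left (by omega)]

/-- For near squares: all four neighbours of a local minimum have equal height, so the edge in
question is absent both before and after raising, whatever the indicators are. -/
theorem mainMatched_corner (H : AgreesOff i j g₂ g a A b B) (p q : ℤ)
    (hg : g (p + 1) q = g p (q + 1)) (h₁ : ¬ (p + 1 = i ∧ q = j)) (h₂ : ¬ (p = i ∧ q + 1 = j)) :
    mainMatched g₂ a b p q = mainMatched g A B p q := by
  unfold mainMatched
  rw [(H.surface (p + 1) q).resolve_left h₁, (H.surface p (q + 1)).resolve_left h₂]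
  simp [hg]

theorem antiMatched_corner (H : AgreesOff i j g₂ g a A b B) (p q : ℤ)
    (hg : g p q = g (p + 1) (q + 1)) (h₁ : ¬ (p = i ∧ q = j)) (h₂ : ¬ (p + 1 = i ∧ q + 1 = j)) :
    antiMatched g₂ a b p q = antiMatched g A B p q := by
  unfold antiMatched
  rw [(H.surface p q).resolve_left h₁, (H.surface (p + 1) (q + 1)).resolve_left h₂]
  simp [hg]

theorem forall_squareValid_iff (H : AgreesOff i j g₂ g a A b B) :
    (∀ p q, SquareValid g₂ a b p q) ↔
      (∀ p q, FarSquare i j p q → SquareValid g A B p q) ∧ SquareValid g₂ a b i j ∧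
        SquareValid g₂ a b (i - 1) j ∧ SquareValid g₂ a b (i - 1) (j - 1) ∧
        SquareValid g₂ a b i (j - 1) := by
  constructor
  · exact fun h => ⟨fun p q hp => (H.squareValid_iff p q hp).1 (h p q), h _ _, h _ _, h _ _, h _ _⟩
  · rintro ⟨h, h₁, h₂, h₃, h₄⟩ p q
    by_cases hp : FarSquare i j p q
    · exact (H.squareValid_iff p q hp).2 (h p q hp)
    · unfold FarSquare at hp
      rw [not_not] at hp
      obtain ⟨rfl | rfl, rfl | rfl⟩ := hp <;> assumption

/-- The wrench edges that raising creates or destroys separate two neighbours of `(i, j)`, never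
`(i, j)` from a diagonal neighbour. Hence only `(i, j)` and its four lattice neighbours can change
exponent. -/
theorem faceExponent_eq (H : AgreesOff i j g₂ g a A b B)
    (hE : g (i + 1) j = g i j + 1) (hN : g i (j + 1) = g i j + 1)
    (hW : g (i - 1) j = g i j + 1) (hS : g i (j - 1) = g i j + 1) (p q : ℤ)
    (h : ¬ (p = i ∧ q = j) ∧ ¬ (p = i + 1 ∧ q = j) ∧ ¬ (p = i ∧ q = j + 1) ∧
      ¬ (p = i - 1 ∧ q = j) ∧ ¬ (p = i ∧ q = j - 1)) :
    faceExponent g₂ a b p q = faceExponent g A B p q := by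
  have main : ∀ p q, ¬ (p = i ∧ q = j - 1) → ¬ (p = i - 1 ∧ q = j) →
      mainMatched g₂ a b p q = mainMatched g A B p q := by
    intro p q h₁ h₂
    by_cases hf : FarSquare i j p q
    · exact H.mainMatched_eq p q hf
    · unfold FarSquare at hf
      refine H.mainMatched_corner p q ?_ (by omega) (by omega)
      obtain ⟨rfl, rfl⟩ | ⟨rfl, rfl⟩ : (p = i ∧ q = j) ∨ (p = i - 1 ∧ q = j - 1) := by omega
      · rw [hE, hN]
      · simp only [sub_add_cancel, hW, hS]
  have anti : ∀ p q, ¬ (p = i ∧ q = j) → ¬ (p = i - 1 ∧ q = j - 1) →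
      antiMatched g₂ a b p q = antiMatched g A B p q := by
    intro p q h₁ h₂
    by_cases hf : FarSquare i j p q
    · exact H.antiMatched_eq p q hf
    · unfold FarSquare at hf
      refine H.antiMatched_corner p q ?_ (by omega) (by omega)
      obtain ⟨rfl, rfl⟩ | ⟨rfl, rfl⟩ : (p = i ∧ q = j - 1) ∨ (p = i - 1 ∧ q = j) := by omega
      · simp only [sub_add_cancel, hE, hS]
      · simp only [sub_add_cancel, hW, hN]
  unfold faceExponent
  rw [main p q (by omega) (by omega), main (p - 1) (q - 1) (by omega) (by omega),
    anti (p - 1) q (by omega) (by omega), anti p (q - 1) (by omega) (by omega),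
    H.mainWrench_eq p q (by omega) (by omega), H.mainWrench_eq (p - 1) (q - 1) (by omega) (by omega),
    H.antiWrench_eq (p - 1) q (by omega) (by omega), H.antiWrench_eq p (q - 1) (by omega) (by omega),
    ((H.horiz p q).resolve_left (by omega)).resolve_left (by omega),
    ((H.horiz (p - 1) q).resolve_left (by omega)).resolve_left (by omega),
    ((H.vert p q).resolve_left (by omega)).resolve_left (by omega),
    ((H.vert p (q - 1)).resolve_left (by omega)).resolve_left (by omega)]

/-- This and the three analogues split the exponent of a neighbour into data outside the modified
region, the two wrenches next to the raised face, and the one shared segment, which is the form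
needed in `renewal_local_sum`. -/
theorem faceExponent_east (H : AgreesOff i j g₂ g a A b B) :
    faceExponent g₂ a b (i + 1) j =
      (4 + mainWrench g (i + 1) j + antiWrench g (i + 1) (j - 1) + mainWrench g₂ i (j - 1) +
        antiWrench g₂ i j) / 2 - 1 - (A (i + 1) j + B (i + 1) j + B (i + 1) (j - 1) +
        mainMatched g A B (i + 1) j + antiMatched g A B (i + 1) (j - 1) +
        mainMatched g₂ a b i (j - 1) + antiMatched g₂ a b i j) - a i j := by
  unfold faceExponent
  rw [H.mainMatched_eq (i + 1) j (by unfold FarSquare; omega),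
    H.antiMatched_eq (i + 1) (j - 1) (by unfold FarSquare; omega),
    H.mainWrench_eq (i + 1) j (by omega) (by omega),
    H.antiWrench_eq (i + 1) (j - 1) (by omega) (by omega),
    ((H.horiz (i + 1) j).resolve_left (by omega)).resolve_left (by omega),
    ((H.vert (i + 1) j).resolve_left (by omega)).resolve_left (by omega),
    ((H.vert (i + 1) (j - 1)).resolve_left (by omega)).resolve_left (by omega),
    add_sub_cancel_right]
  omega

theorem faceExponent_north (H : AgreesOff i j g₂ g a A b B) :
    faceExponent g₂ a b i (j + 1) =
      (4 + mainWrench g i (j + 1) + antiWrench g (i - 1) (j + 1) + mainWrench g₂ (i - 1) j +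
        antiWrench g₂ i j) / 2 - 1 - (A i (j + 1) + A (i - 1) (j + 1) + B i (j + 1) +
        mainMatched g A B i (j + 1) + antiMatched g A B (i - 1) (j + 1) +
        mainMatched g₂ a b (i - 1) j + antiMatched g₂ a b i j) - b i j := by
  unfold faceExponent
  rw [H.mainMatched_eq i (j + 1) (by unfold FarSquare; omega),
    H.antiMatched_eq (i - 1) (j + 1) (by unfold FarSquare; omega),
    H.mainWrench_eq i (j + 1) (by omega) (by omega),
    H.antiWrench_eq (i - 1) (j + 1) (by omega) (by omega),
    ((H.horiz i (j + 1)).resolve_left (by omega)).resolve_left (by omega),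
    ((H.horiz (i - 1) (j + 1)).resolve_left (by omega)).resolve_left (by omega),
    ((H.vert i (j + 1)).resolve_left (by omega)).resolve_left (by omega),
    add_sub_cancel_right]
  omega

theorem faceExponent_west (H : AgreesOff i j g₂ g a A b B) :
    faceExponent g₂ a b (i - 1) j =
      (4 + mainWrench g (i - 1 - 1) (j - 1) + antiWrench g (i - 1 - 1) j +
        mainWrench g₂ (i - 1) j + antiWrench g₂ (i - 1) (j - 1)) / 2 - 1 -
        (A (i - 1 - 1) j + B (i - 1) j + B (i - 1) (j - 1) +
        mainMatched g A B (i - 1 - 1) (j - 1) + antiMatched g A B (i - 1 - 1) j +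
        mainMatched g₂ a b (i - 1) j + antiMatched g₂ a b (i - 1) (j - 1)) - a (i - 1) j := by
  unfold faceExponent
  rw [H.mainMatched_eq (i - 1 - 1) (j - 1) (by unfold FarSquare; omega),
    H.antiMatched_eq (i - 1 - 1) j (by unfold FarSquare; omega),
    H.mainWrench_eq (i - 1 - 1) (j - 1) (by omega) (by omega),
    H.antiWrench_eq (i - 1 - 1) j (by omega) (by omega),
    ((H.horiz (i - 1 - 1) j).resolve_left (by omega)).resolve_left (by omega),
    ((H.vert (i - 1) j).resolve_left (by omega)).resolve_left (by omega),
    ((H.vert (i - 1) (j - 1)).resolve_left (by omega)).resolve_left (by omega)]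
  omega

theorem faceExponent_south (H : AgreesOff i j g₂ g a A b B) :
    faceExponent g₂ a b i (j - 1) =
      (4 + mainWrench g (i - 1) (j - 1 - 1) + antiWrench g i (j - 1 - 1) +
        mainWrench g₂ i (j - 1) + antiWrench g₂ (i - 1) (j - 1)) / 2 - 1 -
        (A i (j - 1) + A (i - 1) (j - 1) + B i (j - 1 - 1) +
        mainMatched g A B (i - 1) (j - 1 - 1) + antiMatched g A B i (j - 1 - 1) +
        mainMatched g₂ a b i (j - 1) + antiMatched g₂ a b (i - 1) (j - 1)) - b i (j - 1) := by
  unfold faceExponent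
  rw [H.mainMatched_eq (i - 1) (j - 1 - 1) (by unfold FarSquare; omega),
    H.antiMatched_eq i (j - 1 - 1) (by unfold FarSquare; omega),
    H.mainWrench_eq (i - 1) (j - 1 - 1) (by omega) (by omega),
    H.antiWrench_eq i (j - 1 - 1) (by omega) (by omega),
    ((H.horiz i (j - 1)).resolve_left (by omega)).resolve_left (by omega),
    ((H.horiz (i - 1) (j - 1)).resolve_left (by omega)).resolve_left (by omega),
    ((H.vert i (j - 1 - 1)).resolve_left (by omega)).resolve_left (by omega)]
  omega

end AgreesOff

/-! ### Invariance of the partition sum under urban renewal. -/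

/-- `(i, j)` is a strict local minimum of the surface `g`, lying one below its neighbours. -/
structure IsSurfaceMin (g : ℤ → ℤ → ℤ) (i j : ℤ) : Prop where
  east : g (i + 1) j = g i j + 1
  north : g i (j + 1) = g i j + 1
  west : g (i - 1) j = g i j + 1
  south : g i (j - 1) = g i j + 1
  northEast : g (i + 1) (j + 1) = g i j ∨ g (i + 1) (j + 1) = g i j + 2
  northWest : g (i - 1) (j + 1) = g i j ∨ g (i - 1) (j + 1) = g i j + 2
  southWest : g (i - 1) (j - 1) = g i j ∨ g (i - 1) (j - 1) = g i j + 2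
  southEast : g (i + 1) (j - 1) = g i j ∨ g (i + 1) (j - 1) = g i j + 2

theorem raiseAt_self (g : ℤ → ℤ → ℤ) (i j : ℤ) : raiseAt g i j i j = g i j + 2 := by
  simp [raiseAt]

theorem raiseAt_of_ne (g : ℤ → ℤ → ℤ) (i j p q : ℤ) (h : ¬ (p = i ∧ q = j)) :
    raiseAt g i j p q = g p q := by
  simp [raiseAt, h]

theorem toInt_eq_zero_or_one (b : Bool) : b.toInt = 0 ∨ b.toInt = 1 := by
  cases b <;> simp

theorem prod_faces_eq (F : Finset (ℤ × ℤ)) (i j : ℤ)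
    (hF : {(i, j), (i + 1, j), (i, j + 1), (i - 1, j), (i, j - 1)} ⊆ F) (φ : ℤ × ℤ → ℚ) :
    ∏ f ∈ F, φ f =
      (∏ f ∈ F \ {(i, j), (i + 1, j), (i, j + 1), (i - 1, j), (i, j - 1)}, φ f) *
        (φ (i, j) * (φ (i + 1, j) * φ (i, j + 1) * φ (i - 1, j) * φ (i, j - 1))) := by
  rw [← Finset.prod_sdiff hF]
  congr 1
  rw [Finset.prod_insert, Finset.prod_insert, Finset.prod_insert, Finset.prod_insert,
    Finset.prod_singleton]
  · ring
  all_goals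
    simp only [Finset.mem_insert, Finset.mem_singleton, Prod.mk.injEq, true_and, and_true]
    omega

-- The sixteen configurations of the four segments at `(i, j)` share everything else. Factoring out
-- the shared validity conditions and face weights reduces the claim to `renewal_local_sum`.
set_option maxHeartbeats 1000000 in
theorem renewal_sum_segWeight {g : ℤ → ℤ → ℤ} {i j : ℤ} (hg : IsSurfaceMin g i j)
    {x x' : ℤ → ℤ → ℚ} (hx0 : ∀ p q, x p q ≠ 0) (hx0' : ∀ p q, x' p q ≠ 0)
    (hx : ∀ p q, ¬ (p = i ∧ q = j) → x' p q = x p q)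
    (hxr : x' i j * x i j = x i (j + 1) * x i (j - 1) + x (i + 1) j * x (i - 1) j)
    {F : Finset (ℤ × ℤ)} (hF : {(i, j), (i + 1, j), (i, j + 1), (i - 1, j), (i, j - 1)} ⊆ F)
    {A B : ℤ → ℤ → ℤ} (hA : ∀ p q, 0 ≤ A p q) (hB : ∀ p q, 0 ≤ B p q)
    {a b : Bool → Bool → Bool → Bool → ℤ → ℤ → ℤ}
    (ha : ∀ e n w s p q, (p = i ∧ q = j) ∨ (p = i - 1 ∧ q = j) ∨ a e n w s p q = A p q)
    (hb : ∀ e n w s p q, (p = i ∧ q = j) ∨ (p = i ∧ q = j - 1) ∨ b e n w s p q = B p q)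
    (hae : ∀ e n w s, a e n w s i j = e.toInt) (hbn : ∀ e n w s, b e n w s i j = n.toInt)
    (haw : ∀ e n w s, a e n w s (i - 1) j = w.toInt)
    (hbs : ∀ e n w s, b e n w s i (j - 1) = s.toInt) :
    (∑ e : Bool, ∑ n : Bool, ∑ w : Bool, ∑ s : Bool,
      segWeight g x F (a e n w s) (b e n w s)) =
    ∑ e : Bool, ∑ n : Bool, ∑ w : Bool, ∑ s : Bool,
      segWeight (raiseAt g i j) x' F (a e n w s) (b e n w s) := by
  obtain ⟨gE, gN, gW, gS, gNE, gNW, gSW, gSE⟩ := hg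
  have rC := raiseAt_self g i j
  have rE := raiseAt_of_ne g i j (i + 1) j (by omega)
  have rN := raiseAt_of_ne g i j i (j + 1) (by omega)
  have rW := raiseAt_of_ne g i j (i - 1) j (by omega)
  have rS := raiseAt_of_ne g i j i (j - 1) (by omega)
  have rNE := raiseAt_of_ne g i j (i + 1) (j + 1) (by omega)
  have rNW := raiseAt_of_ne g i j (i - 1) (j + 1) (by omega)
  have rSW := raiseAt_of_ne g i j (i - 1) (j - 1) (by omega)
  have rSE := raiseAt_of_ne g i j (i + 1) (j - 1) (by omega)
  -- outer counts, inner counts, wrench indicators and matched wrenches at the four squares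
  obtain ⟨o₁, ho₁⟩ : ∃ o, o = A i (j + 1) + B (i + 1) j := ⟨_, rfl⟩
  obtain ⟨o₂, ho₂⟩ : ∃ o, o = A (i - 1) (j + 1) + B (i - 1) j := ⟨_, rfl⟩
  obtain ⟨o₃, ho₃⟩ : ∃ o, o = A (i - 1) (j - 1) + B (i - 1) (j - 1) := ⟨_, rfl⟩
  obtain ⟨o₄, ho₄⟩ : ∃ o, o = A i (j - 1) + B (i + 1) (j - 1) := ⟨_, rfl⟩
  -- A cross needs inner plus outer count 1, so `c = 1 - o`; a wrench needs them equal, so `c = o`.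
  -- Here `X` records the wrench edge and `D` whether it is matched, all for the surface before
  -- raising.
  obtain ⟨c₁, X₁, D₁, hc₁⟩ : ∃ c X D : ℤ,
      (g (i + 1) (j + 1) = g i j ∧ c = 1 - o₁ ∧ X = 0 ∧ D = 0) ∨
      (g (i + 1) (j + 1) = g i j + 2 ∧ c = o₁ ∧ X = 1 ∧ D = 1 - o₁) := by
    rcases gNE with h | h
    exacts [⟨_, _, _, .inl ⟨h, rfl, rfl, rfl⟩⟩, ⟨_, _, _, .inr ⟨h, rfl, rfl, rfl⟩⟩]
  obtain ⟨c₂, X₂, D₂, hc₂⟩ : ∃ c X D : ℤ,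
      (g (i - 1) (j + 1) = g i j ∧ c = 1 - o₂ ∧ X = 0 ∧ D = 0) ∨
      (g (i - 1) (j + 1) = g i j + 2 ∧ c = o₂ ∧ X = 1 ∧ D = 1 - o₂) := by
    rcases gNW with h | h
    exacts [⟨_, _, _, .inl ⟨h, rfl, rfl, rfl⟩⟩, ⟨_, _, _, .inr ⟨h, rfl, rfl, rfl⟩⟩]
  obtain ⟨c₃, X₃, D₃, hc₃⟩ : ∃ c X D : ℤ,
      (g (i - 1) (j - 1) = g i j ∧ c = 1 - o₃ ∧ X = 0 ∧ D = 0) ∨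
      (g (i - 1) (j - 1) = g i j + 2 ∧ c = o₃ ∧ X = 1 ∧ D = 1 - o₃) := by
    rcases gSW with h | h
    exacts [⟨_, _, _, .inl ⟨h, rfl, rfl, rfl⟩⟩, ⟨_, _, _, .inr ⟨h, rfl, rfl, rfl⟩⟩]
  obtain ⟨c₄, X₄, D₄, hc₄⟩ : ∃ c X D : ℤ,
      (g (i + 1) (j - 1) = g i j ∧ c = 1 - o₄ ∧ X = 0 ∧ D = 0) ∨
      (g (i + 1) (j - 1) = g i j + 2 ∧ c = o₄ ∧ X = 1 ∧ D = 1 - o₄) := by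
    rcases gSE with h | h
    exacts [⟨_, _, _, .inl ⟨h, rfl, rfl, rfl⟩⟩, ⟨_, _, _, .inr ⟨h, rfl, rfl, rfl⟩⟩]
  let C : Prop := (c₁ = 0 ∨ c₁ = 1) ∧ (c₂ = 0 ∨ c₂ = 1) ∧ (c₃ = 0 ∨ c₃ = 1) ∧ (c₄ = 0 ∨ c₄ = 1)
  let O : Prop := ∀ p q, AgreesOff.FarSquare i j p q → SquareValid g A B p q
  let P : ℚ := ∏ f ∈ F \ {(i, j), (i + 1, j), (i, j + 1), (i - 1, j), (i, j - 1)},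
    x f.1 f.2 ^ faceExponent g A B f.1 f.2
  obtain ⟨Ae, hAe⟩ : ∃ z, z = (4 + mainWrench g (i + 1) j + antiWrench g (i + 1) (j - 1) +
      X₄ + X₁) / 2 - 1 - (A (i + 1) j + B (i + 1) j + B (i + 1) (j - 1) +
      mainMatched g A B (i + 1) j + antiMatched g A B (i + 1) (j - 1) + D₄ + D₁) := ⟨_, rfl⟩
  obtain ⟨An, hAn⟩ : ∃ z, z = (4 + mainWrench g i (j + 1) + antiWrench g (i - 1) (j + 1) +
      X₂ + X₁) / 2 - 1 - (A i (j + 1) + A (i - 1) (j + 1) + B i (j + 1) +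
      mainMatched g A B i (j + 1) + antiMatched g A B (i - 1) (j + 1) + D₂ + D₁) := ⟨_, rfl⟩
  obtain ⟨Aw, hAw⟩ : ∃ z, z = (4 + mainWrench g (i - 1 - 1) (j - 1) +
      antiWrench g (i - 1 - 1) j + X₂ + X₃) / 2 - 1 -
      (A (i - 1 - 1) j + B (i - 1) j + B (i - 1) (j - 1) + mainMatched g A B (i - 1 - 1) (j - 1) +
      antiMatched g A B (i - 1 - 1) j + D₂ + D₃) := ⟨_, rfl⟩
  obtain ⟨As, hAs⟩ : ∃ z, z = (4 + mainWrench g (i - 1) (j - 1 - 1) +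
      antiWrench g i (j - 1 - 1) + X₄ + X₃) / 2 - 1 -
      (A i (j - 1) + A (i - 1) (j - 1) + B i (j - 1 - 1) + mainMatched g A B (i - 1) (j - 1 - 1) +
      antiMatched g A B i (j - 1 - 1) + D₄ + D₃) := ⟨_, rfl⟩
  have bds : 0 ≤ o₁ ∧ 0 ≤ o₂ ∧ 0 ≤ o₃ ∧ 0 ≤ o₄ := by
    have := hA i (j + 1); have := hA (i - 1) (j + 1); have := hA (i - 1) (j - 1)
    have := hA i (j - 1); have := hB (i + 1) j; have := hB (i - 1) j
    have := hB (i - 1) (j - 1); have := hB (i + 1) (j - 1)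
    omega
  classical
  -- One factorisation serves both surfaces: the two alternatives in the last hypothesis are the
  -- surface before and after raising. `O ∧ C` is the part of validity that does not involve the
  -- four segments and is the same in both.
  have key : ∀ (g₂ : ℤ → ℤ → ℤ) (x₂ : ℤ → ℤ → ℚ) (d₁ d₂ d₃ d₄ Ae' An' Aw' As' : ℤ),
      (∀ p q, (p = i ∧ q = j) ∨ g₂ p q = g p q) →
      (∀ p q, ¬ (p = i ∧ q = j) → x₂ p q = x p q) →
      ((g₂ i j = g i j ∧ d₁ = c₁ ∧ d₂ = c₂ ∧ d₃ = c₃ ∧ d₄ = c₄ ∧ Ae' = Ae ∧ An' = An ∧ Aw' = Aw ∧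
        As' = As) ∨
       (g₂ i j = g i j + 2 ∧ d₁ = 1 - c₁ ∧ d₂ = 1 - c₂ ∧ d₃ = 1 - c₃ ∧ d₄ = 1 - c₄ ∧
        Ae' = Ae + 1 - c₁ - c₄ ∧ An' = An + 1 - c₁ - c₂ ∧ Aw' = Aw + 1 - c₂ - c₃ ∧
        As' = As + 1 - c₃ - c₄)) →
      ∀ e n w s, segWeight g₂ x₂ F (a e n w s) (b e n w s) =
        if O ∧ C then P * (if (e.toInt + n.toInt = d₁ ∧ n.toInt + w.toInt = d₂ ∧
            w.toInt + s.toInt = d₃ ∧ s.toInt + e.toInt = d₄) then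
          x₂ i j ^ (1 - e.toInt - n.toInt - w.toInt - s.toInt) * (x (i + 1) j ^ (Ae' - e.toInt) *
          x i (j + 1) ^ (An' - n.toInt) * x (i - 1) j ^ (Aw' - w.toInt) *
          x i (j - 1) ^ (As' - s.toInt)) else 0) else 0 := by
    intro g₂ x₂ d₁ d₂ d₃ d₄ Ae' An' Aw' As' hg₂ hx₂ hd e n w s
    have H : AgreesOff i j g₂ g (a e n w s) A (b e n w s) B := ⟨hg₂, ha e n w s, hb e n w s⟩
    have H' := H.forall_squareValid_iff
    have fE := H.faceExponent_east
    have fN := H.faceExponent_north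
    have fW := H.faceExponent_west
    have fS := H.faceExponent_south
    have fO := H.faceExponent_eq gE gN gW gS
    have sE := (hg₂ (i + 1) j).resolve_left (by omega)
    have sN := (hg₂ i (j + 1)).resolve_left (by omega)
    have sW := (hg₂ (i - 1) j).resolve_left (by omega)
    have sS := (hg₂ i (j - 1)).resolve_left (by omega)
    have sNE := (hg₂ (i + 1) (j + 1)).resolve_left (by omega)
    have sNW := (hg₂ (i - 1) (j + 1)).resolve_left (by omega)
    have sSW := (hg₂ (i - 1) (j - 1)).resolve_left (by omega)
    have sSE := (hg₂ (i + 1) (j - 1)).resolve_left (by omega)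
    have a1 := ((ha e n w s i (j + 1)).resolve_left (by omega)).resolve_left (by omega)
    have a2 := ((ha e n w s (i - 1) (j + 1)).resolve_left (by omega)).resolve_left (by omega)
    have a3 := ((ha e n w s (i - 1) (j - 1)).resolve_left (by omega)).resolve_left (by omega)
    have a4 := ((ha e n w s i (j - 1)).resolve_left (by omega)).resolve_left (by omega)
    have b1 := ((hb e n w s (i + 1) j).resolve_left (by omega)).resolve_left (by omega)
    have b2 := ((hb e n w s (i - 1) j).resolve_left (by omega)).resolve_left (by omega)
    have b3 := ((hb e n w s (i - 1) (j - 1)).resolve_left (by omega)).resolve_left (by omega)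
    have b4 := ((hb e n w s (i + 1) (j - 1)).resolve_left (by omega)).resolve_left (by omega)
    have ve := hae e n w s
    have vn := hbn e n w s
    have vw := haw e n w s
    have vs := hbs e n w s
    have te := toInt_eq_zero_or_one e
    have tn := toInt_eq_zero_or_one n
    have tw := toInt_eq_zero_or_one w
    have ts := toInt_eq_zero_or_one s
    generalize a e n w s = a' at *
    generalize b e n w s = b' at *
    generalize e.toInt = e' at *
    generalize n.toInt = n' at *
    generalize w.toInt = w' at *
    generalize s.toInt = s' at *
    have q₁ : SquareValid g₂ a' b' i j ↔ ((c₁ = 0 ∨ c₁ = 1) ∧ e' + n' = d₁) := by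
      unfold SquareValid
      rw [sE, sN, sNE, a1, b1, ve, vn]
      clear * - hd ho₁ hc₁ bds gE gN gW gS te tn
      omega
    have q₂ : SquareValid g₂ a' b' (i - 1) j ↔ ((c₂ = 0 ∨ c₂ = 1) ∧ n' + w' = d₂) := by
      unfold SquareValid
      rw [sub_add_cancel, sN, sW, sNW, a2, b2, vw, vn]
      clear * - hd ho₂ hc₂ bds gE gN gW gS tn tw
      omega
    have q₃ : SquareValid g₂ a' b' (i - 1) (j - 1) ↔ ((c₃ = 0 ∨ c₃ = 1) ∧ w' + s' = d₃) := by
      unfold SquareValid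
      rw [sub_add_cancel, sub_add_cancel, sS, sW, sSW, a3, b3, vw, vs]
      clear * - hd ho₃ hc₃ bds gE gN gW gS tw ts
      omega
    have q₄ : SquareValid g₂ a' b' i (j - 1) ↔ ((c₄ = 0 ∨ c₄ = 1) ∧ s' + e' = d₄) := by
      unfold SquareValid
      rw [sub_add_cancel, sE, sS, sSE, a4, b4, ve, vs]
      clear * - hd ho₄ hc₄ bds gE gN gW gS ts te
      omega
    rw [q₁, q₂, q₃, q₄] at H'
    unfold segWeight
    by_cases hOC : O ∧ C
    · by_cases hI : e' + n' = d₁ ∧ n' + w' = d₂ ∧ w' + s' = d₃ ∧ s' + e' = d₄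
      · obtain ⟨hO, hC₁, hC₂, hC₃, hC₄⟩ := hOC
        obtain ⟨i₁, i₂, i₃, i₄⟩ := hI
        rw [if_pos (H'.2 ⟨hO, ⟨hC₁, i₁⟩, ⟨hC₂, i₂⟩, ⟨hC₃, i₃⟩, ⟨hC₄, i₄⟩⟩),
          if_pos ⟨hO, hC₁, hC₂, hC₃, hC₄⟩, if_pos ⟨i₁, i₂, i₃, i₄⟩,
          prod_faces_eq F i j hF]
        congr 1
        · refine Finset.prod_congr rfl fun f hf => ?_
          simp only [Finset.mem_sdiff, Finset.mem_insert, Finset.mem_singleton, Prod.ext_iff,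
            not_or] at hf
          rw [hx₂ _ _ hf.2.1, fO _ _ ⟨hf.2.1, hf.2.2.1, hf.2.2.2.1, hf.2.2.2.2.1, hf.2.2.2.2.2⟩]
        -- Raising exchanges cross and wrench, so `X` becomes `1 - X`. The matched wrench indicator
        -- becomes `D + c - X`: this is `1 - o` when a cross opens into a wrench and `0` when a
        -- wrench closes.
        · have m₁ : antiWrench g₂ i j = (if g₂ i j = g i j then X₁ else 1 - X₁) ∧
              antiMatched g₂ a' b' i j = (if g₂ i j = g i j then D₁ else D₁ + c₁ - X₁) := by
            unfold antiWrench antiMatched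
            rw [sNE, ve, vn]
            clear * - hd hc₁ i₁ i₂ i₃ i₄ ho₁ gE gN gW gS
            rcases hd with hd | hd <;> rcases hc₁ with hc | hc <;> constructor <;> omega
          have m₂ : mainWrench g₂ (i - 1) j = (if g₂ i j = g i j then X₂ else 1 - X₂) ∧
              mainMatched g₂ a' b' (i - 1) j = (if g₂ i j = g i j then D₂ else D₂ + c₂ - X₂) := by
            unfold mainWrench mainMatched
            rw [sub_add_cancel, sNW, vn, vw]
            clear * - hd hc₂ i₁ i₂ i₃ i₄ ho₂ gE gN gW gS
            rcases hd with hd | hd <;> rcases hc₂ with hc | hc <;> constructor <;> omega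
          have m₃ : antiWrench g₂ (i - 1) (j - 1) = (if g₂ i j = g i j then X₃ else 1 - X₃) ∧
              antiMatched g₂ a' b' (i - 1) (j - 1) =
                (if g₂ i j = g i j then D₃ else D₃ + c₃ - X₃) := by
            unfold antiWrench antiMatched
            rw [sub_add_cancel, sub_add_cancel, sSW, a3, b3]
            clear * - hd hc₃ i₁ i₂ i₃ i₄ ho₃ gE gN gW gS
            rcases hd with hd | hd <;> rcases hc₃ with hc | hc <;> constructor <;> omega
          have m₄ : mainWrench g₂ i (j - 1) = (if g₂ i j = g i j then X₄ else 1 - X₄) ∧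
              mainMatched g₂ a' b' i (j - 1) = (if g₂ i j = g i j then D₄ else D₄ + c₄ - X₄) := by
            unfold mainWrench mainMatched
            rw [sub_add_cancel, sSE, a4, b4]
            clear * - hd hc₄ i₁ i₂ i₃ i₄ ho₄ gE gN gW gS
            rcases hd with hd | hd <;> rcases hc₄ with hc | hc <;> constructor <;> omega
          -- The four neighbours have equal height, so no wrench edge borders this face: it has four
          -- edges, and 4/2 - 1 = 1.
          have fC : faceExponent g₂ a' b' i j = 1 - e' - n' - w' - s' := by
            unfold faceExponent mainWrench antiWrench mainMatched antiMatched
            simp only [sub_add_cancel]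
            rw [sE, sN, sW, sS, gE, gN, gW, gS, ve, vn, vw, vs]
            simp only [if_true]
            clear * -
            omega
          rw [m₄.1, m₁.1, m₄.2, m₁.2, ve] at fE
          rw [m₂.1, m₁.1, m₂.2, m₁.2, vn] at fN
          rw [m₂.1, m₃.1, m₂.2, m₃.2, vw] at fW
          rw [m₄.1, m₃.1, m₄.2, m₃.2, vs] at fS
          -- Integer division does no harm: replacing `X₄ + X₁` by `2 - X₄ - X₁` changes the
          -- numerator by an even number.
          have eE : faceExponent g₂ a' b' (i + 1) j = Ae' - e' := by
            rw [fE]; clear * - hd hAe; omega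
          have eN : faceExponent g₂ a' b' i (j + 1) = An' - n' := by
            rw [fN]; clear * - hd hAn; omega
          have eW : faceExponent g₂ a' b' (i - 1) j = Aw' - w' := by
            rw [fW]; clear * - hd hAw; omega
          have eS : faceExponent g₂ a' b' i (j - 1) = As' - s' := by
            rw [fS]; clear * - hd hAs; omega
          dsimp only
          rw [fC, eE, eN, eW, eS, hx₂ (i + 1) j (by omega), hx₂ i (j + 1) (by omega),
            hx₂ (i - 1) j (by omega), hx₂ i (j - 1) (by omega)]
      · rw [if_pos hOC, if_neg hI, if_neg (fun h => hI ?_), mul_zero]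
        obtain ⟨-, ⟨-, i₁⟩, ⟨-, i₂⟩, ⟨-, i₃⟩, ⟨-, i₄⟩⟩ := H'.1 h
        exact ⟨i₁, i₂, i₃, i₄⟩
    · rw [if_neg hOC, if_neg (fun h => hOC ?_)]
      obtain ⟨hO, ⟨i₁, -⟩, ⟨i₂, -⟩, ⟨i₃, -⟩, ⟨i₄, -⟩⟩ := H'.1 h
      exact ⟨hO, i₁, i₂, i₃, i₄⟩
  have kL := key g x c₁ c₂ c₃ c₄ Ae An Aw As (fun _ _ => .inr rfl) (fun _ _ _ => rfl)
    (.inl ⟨rfl, rfl, rfl, rfl, rfl, rfl, rfl, rfl, rfl⟩)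
  have kR := key (raiseAt g i j) x' _ _ _ _ _ _ _ _
    (fun p q => or_iff_not_imp_left.2 (raiseAt_of_ne g i j p q)) hx
    (.inr ⟨rC, rfl, rfl, rfl, rfl, rfl, rfl, rfl, rfl⟩)
  simp only [kL, kR]
  by_cases hOC : O ∧ C
  · simp only [if_pos hOC, ← Finset.mul_sum]
    obtain ⟨-, hC₁, hC₂, hC₃, hC₄⟩ := hOC
    rw [renewal_local_sum (hx0 i j) (hx0' i j) (hx0 _ _) (hx0 _ _) (hx0 _ _) (hx0 _ _) hxr
      hC₁ hC₂ hC₃ hC₄]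
  · simp only [if_neg hOC]

/-- `insert e T` or `T`, according to `β`. -/
def insertIf {α : Type*} [DecidableEq α] (β : Bool) (e : α) (T : Finset α) : Finset α :=
  if β then insert e T else T

theorem mem_insertIf {α : Type*} [DecidableEq α] {β : Bool} {e t : α} {T : Finset α} :
    t ∈ insertIf β e T ↔ (β = true ∧ t = e) ∨ t ∈ T := by
  cases β <;> simp [insertIf]

theorem sum_powerset_insert_bool {α : Type*} [DecidableEq α] {e : α} {E : Finset α} (he : e ∉ E)
    (φ : Finset α → ℚ) :
    ∑ S ∈ (insert e E).powerset, φ S =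
      ∑ S ∈ E.powerset, ∑ β : Bool, φ (insertIf β e S) := by
  rw [Finset.sum_powerset_insert he, ← Finset.sum_add_distrib]
  refine Finset.sum_congr rfl fun S _ => ?_
  simp [insertIf, add_comm]

/-- Urban renewal: raising the surface at a local minimum preserves the partition sum. -/
theorem partitionSum_raiseAt {g : ℤ → ℤ → ℤ} {i j : ℤ} (hg : IsSurfaceMin g i j)
    {x x' : ℤ → ℤ → ℚ} (hx0 : ∀ p q, x p q ≠ 0) (hx0' : ∀ p q, x' p q ≠ 0)
    (hx : ∀ p q, ¬ (p = i ∧ q = j) → x' p q = x p q)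
    (hxr : x' i j * x i j = x i (j + 1) * x i (j - 1) + x (i + 1) j * x (i - 1) j)
    {F : Finset (ℤ × ℤ)} (hF : {(i, j), (i + 1, j), (i, j + 1), (i - 1, j), (i, j - 1)} ⊆ F)
    {E : Finset (Bool × ℤ × ℤ)}
    (hE : {(false, i, j), (true, i, j), (false, i - 1, j), (true, i, j - 1)} ⊆ E) :
    partitionSum g x E F = partitionSum (raiseAt g i j) x' E F := by
  set E₀ := E \ {(false, i, j), (true, i, j), (false, i - 1, j), (true, i, j - 1)} with hE₀
  -- Each insertion that is split off puts its Boolean sum inside the outer one, so this order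
  -- yields the sums in the order `e n w s`.
  have hE₁ : E = insert (true, i, j - 1) (insert (false, i - 1, j)
      (insert (true, i, j) (insert (false, i, j) E₀))) := by
    ext s
    simp only [hE₀, Finset.mem_insert, Finset.mem_sdiff, Finset.mem_singleton]
    have := @hE s
    simp only [Finset.mem_insert, Finset.mem_singleton] at this
    tauto
  have n₁ : (false, i, j) ∉ E₀ := by simp [hE₀]
  have n₂ : (true, i, j) ∉ E₀ := by simp [hE₀]
  have n₃ : (false, i - 1, j) ∉ E₀ := by simp [hE₀]
  have n₄ : (true, i, j - 1) ∉ E₀ := by simp [hE₀]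
  unfold partitionSum
  rw [hE₁]
  iterate 8 rw [sum_powerset_insert_bool (by simp [n₁, n₂, n₃, n₄])]
  refine Finset.sum_congr rfl fun S hS => ?_
  rw [Finset.mem_powerset] at hS
  have m₁ : (false, i, j) ∉ S := fun h => n₁ (hS h)
  have m₂ : (true, i, j) ∉ S := fun h => n₂ (hS h)
  have m₃ : (false, i - 1, j) ∉ S := fun h => n₃ (hS h)
  have m₄ : (true, i, j - 1) ∉ S := fun h => n₄ (hS h)
  let T (e n w s : Bool) : Finset (Bool × ℤ × ℤ) :=
    insertIf s (true, i, j - 1) (insertIf w (false, i - 1, j)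
      (insertIf n (true, i, j) (insertIf e (false, i, j) S)))
  have hT : ∀ e n w s t, t ∈ T e n w s ↔ (s = true ∧ t = (true, i, j - 1)) ∨
      (w = true ∧ t = (false, i - 1, j)) ∨ (n = true ∧ t = (true, i, j)) ∨
      (e = true ∧ t = (false, i, j)) ∨ t ∈ S := by
    intro e n w s t
    simp only [T, mem_insertIf]
  have hi : i ≠ i - 1 := by omega
  have hj : j ≠ j - 1 := by omega
  refine renewal_sum_segWeight (A := segInd S false) (B := segInd S true)
    (a := fun e n w s => segInd (T e n w s) false)
    (b := fun e n w s => segInd (T e n w s) true) hg hx0 hx0' hx hxr hF ?_ ?_ ?_ ?_ ?_ ?_ ?_ ?_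
  · intro p q; unfold segInd; split_ifs <;> simp
  · intro p q; unfold segInd; split_ifs <;> simp
  · intro e n w s p q
    by_cases h1 : p = i ∧ q = j
    · exact .inl h1
    by_cases h2 : p = i - 1 ∧ q = j
    · exact .inr (.inl h2)
    refine .inr (.inr ?_)
    simp [segInd, hT, h1, h2]
  · intro e n w s p q
    by_cases h1 : p = i ∧ q = j
    · exact .inl h1
    by_cases h2 : p = i ∧ q = j - 1
    · exact .inr (.inl h2)
    refine .inr (.inr ?_)
    simp [segInd, hT, h1, h2]
  all_goals
    intro e n w s
    simp only [segInd, hT]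
  · cases e <;> simp [m₁, hi]
  · cases n <;> simp [m₂, hj]
  · cases w <;> simp [m₃, hi.symm]
  · cases s <;> simp [m₄, hj.symm]

/-! ### No matched segment has both ends on the cone. -/

theorem abs_add_one_sub (i i₀ : ℤ) : |i + 1 - i₀| = |i - i₀| + (if i₀ ≤ i then 1 else -1) := by
  split_ifs with h
  · rw [abs_of_nonneg (by omega), abs_of_nonneg (by omega)]; ring
  · rw [abs_of_nonpos (by omega), abs_of_neg (by omega)]; ring

theorem abs_sub_one_sub (i i₀ : ℤ) : |i - 1 - i₀| = |i - i₀| + (if i₀ < i then -1 else 1) := by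
  split_ifs with h
  · rw [abs_of_nonneg (by omega), abs_of_pos (by omega)]; ring
  · rw [abs_of_neg (by omega), abs_of_nonpos (by omega)]; ring

/-- Neighbouring values of `g` differ by one. -/
def IsStepSurface (g : ℤ → ℤ → ℤ) : Prop :=
  ∀ i j, (g (i + 1) j = g i j + 1 ∨ g (i + 1) j = g i j - 1) ∧
    (g i (j + 1) = g i j + 1 ∨ g i (j + 1) = g i j - 1)

theorem segInd_eq_one_iff {S : Finset (Bool × ℤ × ℤ)} {k : Bool} {i j : ℤ} :
    segInd S k i j = 1 ↔ (k, i, j) ∈ S := by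
  simp [segInd]

theorem segInd_eq_zero_or_one (S : Finset (Bool × ℤ × ℤ)) (k : Bool) (i j : ℤ) :
    segInd S k i j = 0 ∨ segInd S k i j = 1 := by
  unfold segInd; split_ifs <;> simp

/-- Moving away from the apex, the cone drops by the full step, and a step surface below it that
touches it cannot drop faster. So contact with the cone propagates outwards; likewise in the other
three directions. -/
theorem open_east {n₀ i₀ j₀ : ℤ} {g : ℤ → ℤ → ℤ} (hg : IsStepSurface g)
    (hle : ∀ i j, g i j ≤ coneHeight n₀ i₀ j₀ i j) {i j : ℤ} (hi : i₀ ≤ i)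
    (h : g i j = coneHeight n₀ i₀ j₀ i j) : g (i + 1) j = coneHeight n₀ i₀ j₀ (i + 1) j := by
  have h₁ := (hg i j).1
  have h₂ := hle (i + 1) j
  unfold coneHeight at *
  rw [abs_add_one_sub, if_pos hi] at *
  omega

theorem open_north {n₀ i₀ j₀ : ℤ} {g : ℤ → ℤ → ℤ} (hg : IsStepSurface g)
    (hle : ∀ i j, g i j ≤ coneHeight n₀ i₀ j₀ i j) {i j : ℤ} (hj : j₀ ≤ j)
    (h : g i j = coneHeight n₀ i₀ j₀ i j) : g i (j + 1) = coneHeight n₀ i₀ j₀ i (j + 1) := by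
  have h₁ := (hg i j).2
  have h₂ := hle i (j + 1)
  unfold coneHeight at *
  rw [abs_add_one_sub, if_pos hj] at *
  omega

theorem open_west {n₀ i₀ j₀ : ℤ} {g : ℤ → ℤ → ℤ} (hg : IsStepSurface g)
    (hle : ∀ i j, g i j ≤ coneHeight n₀ i₀ j₀ i j) {i j : ℤ} (hi : i ≤ i₀)
    (h : g i j = coneHeight n₀ i₀ j₀ i j) : g (i - 1) j = coneHeight n₀ i₀ j₀ (i - 1) j := by
  have h₁ := (hg (i - 1) j).1
  have h₂ := hle (i - 1) j
  unfold coneHeight at *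
  rw [abs_sub_one_sub, if_neg (by omega)] at *
  rw [sub_add_cancel] at h₁
  omega

theorem open_south {n₀ i₀ j₀ : ℤ} {g : ℤ → ℤ → ℤ} (hg : IsStepSurface g)
    (hle : ∀ i j, g i j ≤ coneHeight n₀ i₀ j₀ i j) {i j : ℤ} (hj : j ≤ j₀)
    (h : g i j = coneHeight n₀ i₀ j₀ i j) : g i (j - 1) = coneHeight n₀ i₀ j₀ i (j - 1) := by
  have h₁ := (hg i (j - 1)).2
  have h₂ := hle i (j - 1)
  unfold coneHeight at *
  rw [abs_sub_one_sub, if_neg (by omega)] at *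
  rw [sub_add_cancel] at h₁
  omega

/-- In a square where the surface is the cone, matched segments come in pairs. -/
theorem SquareValid.flow {n₀ i₀ j₀ : ℤ} {g a b : ℤ → ℤ → ℤ} {i j : ℤ}
    (hv : SquareValid g a b i j)
    (h₁ : g i j = coneHeight n₀ i₀ j₀ i j) (h₂ : g (i + 1) j = coneHeight n₀ i₀ j₀ (i + 1) j)
    (h₃ : g i (j + 1) = coneHeight n₀ i₀ j₀ i (j + 1))
    (h₄ : g (i + 1) (j + 1) = coneHeight n₀ i₀ j₀ (i + 1) (j + 1)) :
    ((i₀ ≤ i ↔ j₀ ≤ j) ∧ a i j + b i j = a i (j + 1) + b (i + 1) j) ∨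
      (¬ (i₀ ≤ i ↔ j₀ ≤ j) ∧ a i j + b (i + 1) j = a i (j + 1) + b i j) := by
  obtain ⟨-, v₁, v₂⟩ := hv
  unfold coneHeight at *
  rw [abs_add_one_sub] at h₂ h₃ h₄
  rw [abs_add_one_sub] at h₄
  by_cases hi : i₀ ≤ i <;> by_cases hj : j₀ ≤ j <;> simp only [hi, hj, if_true, if_false] at h₂ h₃ h₄
  · exact .inl ⟨by simp [hi, hj], (v₂ (by omega)).1⟩
  · exact .inr ⟨by simp [hi, hj], (v₁ (by omega)).1⟩
  · exact .inr ⟨by simp [hi, hj], (v₁ (by omega)).1⟩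
  · exact .inl ⟨by simp [hi, hj], (v₂ (by omega)).1⟩

/-- The second end of a segment. -/
def segEnd (s : Bool × ℤ × ℤ) : ℤ × ℤ :=
  if s.1 then (s.2.1, s.2.2 + 1) else (s.2.1 + 1, s.2.2)

/-- In a square lying on the cone, the two sides nearer the apex carry as many matched segments as
the two farther ones. A matched segment with both ends on the cone would thus force another one
farther out, without end, contradicting the finiteness of `S`. -/
theorem exists_closed_of_mem {n₀ i₀ j₀ : ℤ} {g : ℤ → ℤ → ℤ} (hg : IsStepSurface g)
    (hle : ∀ i j, g i j ≤ coneHeight n₀ i₀ j₀ i j) {S : Finset (Bool × ℤ × ℤ)}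
    (hS : ∀ i j, SquareValid g (segInd S false) (segInd S true) i j) {s : Bool × ℤ × ℤ}
    (hs : s ∈ S) : g s.2.1 s.2.2 < coneHeight n₀ i₀ j₀ s.2.1 s.2.2 ∨
      g (segEnd s).1 (segEnd s).2 < coneHeight n₀ i₀ j₀ (segEnd s).1 (segEnd s).2 := by
  by_contra hcon
  let T := S.filter fun s => g s.2.1 s.2.2 = coneHeight n₀ i₀ j₀ s.2.1 s.2.2 ∧
      g (segEnd s).1 (segEnd s).2 = coneHeight n₀ i₀ j₀ (segEnd s).1 (segEnd s).2
  have hT : T.Nonempty := by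
    refine ⟨s, Finset.mem_filter.2 ⟨hs, ?_⟩⟩
    have h₁ := hle s.2.1 s.2.2
    have h₂ := hle (segEnd s).1 (segEnd s).2
    omega
  obtain ⟨⟨k, i, j⟩, ht, hmax⟩ := T.exists_max_image (fun s : Bool × ℤ × ℤ =>
    |s.2.1 - i₀| + |s.2.2 - j₀| + |(segEnd s).1 - i₀| + |(segEnd s).2 - j₀|) hT
  obtain ⟨hmem, o₁, o₂⟩ := Finset.mem_filter.1 ht
  have hH : ∀ p q, g p q = coneHeight n₀ i₀ j₀ p q →
      g (p + 1) q = coneHeight n₀ i₀ j₀ (p + 1) q → segInd S false p q = 1 →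
      |p - i₀| + |q - j₀| + |p + 1 - i₀| + |q - j₀| ≤
        |i - i₀| + |j - j₀| + |(segEnd (k, i, j)).1 - i₀| + |(segEnd (k, i, j)).2 - j₀| :=
    fun p q h₁ h₂ h => hmax (false, p, q) (Finset.mem_filter.2 ⟨segInd_eq_one_iff.1 h, h₁, h₂⟩)
  have hV : ∀ p q, g p q = coneHeight n₀ i₀ j₀ p q →
      g p (q + 1) = coneHeight n₀ i₀ j₀ p (q + 1) → segInd S true p q = 1 →
      |p - i₀| + |q - j₀| + |p - i₀| + |q + 1 - j₀| ≤
        |i - i₀| + |j - j₀| + |(segEnd (k, i, j)).1 - i₀| + |(segEnd (k, i, j)).2 - j₀| :=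
    fun p q h₁ h₂ h => hmax (true, p, q) (Finset.mem_filter.2 ⟨segInd_eq_one_iff.1 h, h₁, h₂⟩)
  have z := segInd_eq_zero_or_one S
  rw [← segInd_eq_one_iff] at hmem
  cases k
  · have o₂' : g (i + 1) j = coneHeight n₀ i₀ j₀ (i + 1) j := o₂
    simp only [segEnd, Bool.false_eq_true, if_false] at hH hV
    -- Use the square on the side of the segment away from the apex: its four corners lie on the
    -- cone, and the given segment is one of its inner sides.
    by_cases hj : j₀ ≤ j
    · have o₃ := open_north hg hle hj o₁
      have o₄ := open_north hg hle hj o₂'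
      have f := (hS i j).flow o₁ o₂' o₃ o₄
      have m₁ := hH i (j + 1) o₃ o₄
      have m₂ := hV i j o₁ o₃
      have m₃ := hV (i + 1) j o₂' o₄
      have z₁ := z false i (j + 1)
      have z₂ := z true i j
      have z₃ := z true (i + 1) j
      rw [abs_add_one_sub j, abs_add_one_sub i] at *
      dsimp only at *
      omega
    · have o₃ := open_south hg hle (by omega : j ≤ j₀) o₁
      have o₄ := open_south hg hle (by omega : j ≤ j₀) o₂'
      have f := (hS i (j - 1)).flow o₃ o₄ (by simpa using o₁) (by simpa using o₂')
      have m₁ := hH i (j - 1) o₃ o₄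
      have m₂ := hV i (j - 1) o₃ (by simpa using o₁)
      have m₃ := hV (i + 1) (j - 1) o₄ (by simpa using o₂')
      have z₁ := z false i (j - 1)
      have z₂ := z true i (j - 1)
      have z₃ := z true (i + 1) (j - 1)
      simp only [sub_add_cancel] at f m₂ m₃
      rw [abs_sub_one_sub j, abs_add_one_sub i] at *
      dsimp only at *
      omega
  · have o₂' : g i (j + 1) = coneHeight n₀ i₀ j₀ i (j + 1) := o₂
    simp only [segEnd, if_true] at hH hV
    by_cases hi : i₀ ≤ i
    · have o₃ := open_east hg hle hi o₁
      have o₄ := open_east hg hle hi o₂'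
      have f := (hS i j).flow o₁ o₃ o₂' o₄
      have m₁ := hV (i + 1) j o₃ o₄
      have m₂ := hH i j o₁ o₃
      have m₃ := hH i (j + 1) o₂' o₄
      have z₁ := z true (i + 1) j
      have z₂ := z false i j
      have z₃ := z false i (j + 1)
      rw [abs_add_one_sub j, abs_add_one_sub i] at *
      dsimp only at *
      omega
    · have o₃ := open_west hg hle (by omega : i ≤ i₀) o₁
      have o₄ := open_west hg hle (by omega : i ≤ i₀) o₂'
      have f := (hS (i - 1) j).flow o₃ (by simpa using o₁) o₄ (by simpa using o₂')
      have m₁ := hV (i - 1) j o₃ o₄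
      have m₂ := hH (i - 1) j o₃ (by simpa using o₁)
      have m₃ := hH (i - 1) (j + 1) o₄ (by simpa using o₂')
      have z₁ := z true (i - 1) j
      have z₂ := z false (i - 1) j
      have z₃ := z false (i - 1) (j + 1)
      simp only [sub_add_cancel] at f m₂ m₃
      rw [abs_sub_one_sub i, abs_add_one_sub j] at *
      dsimp only at *
      omega

/-! ### The partition sum of the cone. -/

theorem isStepSurface_cone (n₀ i₀ j₀ : ℤ) : IsStepSurface (coneHeight n₀ i₀ j₀) := by
  intro i j
  unfold coneHeight
  rw [abs_add_one_sub, abs_add_one_sub]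
  split_ifs <;> omega

theorem squareValid_cone (n₀ i₀ j₀ i j : ℤ) :
    SquareValid (coneHeight n₀ i₀ j₀) (fun _ _ => 0) (fun _ _ => 0) i j := by
  unfold SquareValid coneHeight
  rw [abs_add_one_sub, abs_add_one_sub]
  refine ⟨fun h => ?_, by simp, by simp⟩
  split_ifs at h <;> omega

/-- Every square of the cone holds a wrench, and with no segment matched all wrench edges are
matched. The apex is a quadrilateral without wrench edges, giving 2 - 1 - 0; every other face is a
hexagon with two of them, giving 3 - 1 - 2. -/
theorem faceExponent_cone (n₀ i₀ j₀ i j : ℤ) :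
    faceExponent (coneHeight n₀ i₀ j₀) (fun _ _ => 0) (fun _ _ => 0) i j =
      if i = i₀ ∧ j = j₀ then 1 else 0 := by
  unfold faceExponent mainWrench antiWrench mainMatched antiMatched coneHeight
  simp only [sub_add_cancel]
  rw [abs_add_one_sub, abs_add_one_sub, abs_sub_one_sub, abs_sub_one_sub]
  generalize |i - i₀| = u
  generalize |j - j₀| = v
  rcases lt_trichotomy i i₀ with hi | hi | hi <;> rcases lt_trichotomy j j₀ with hj | hj | hj <;>
    simp only [hi, hj, not_lt_of_gt, le_of_lt, not_le_of_gt, le_refl, lt_irrefl, ne_of_lt, ne_of_gt,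
      if_true, if_false, and_self, and_true, true_and] <;>
    split_ifs <;> omega

theorem partitionSum_cone {n₀ i₀ j₀ : ℤ} (x : ℤ → ℤ → ℚ) (E : Finset (Bool × ℤ × ℤ))
    {F : Finset (ℤ × ℤ)} (hF : (i₀, j₀) ∈ F) :
    partitionSum (coneHeight n₀ i₀ j₀) x E F = x i₀ j₀ := by
  have hz : ∀ k, segInd ∅ k = fun _ _ => 0 := by
    intro k; funext p q; simp [segInd]
  unfold partitionSum
  rw [Finset.sum_eq_single ∅]
  · unfold segWeight
    rw [hz, hz, if_pos (squareValid_cone n₀ i₀ j₀), Finset.prod_eq_single_of_mem _ hF]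
    · simp [faceExponent_cone]
    · rintro ⟨p, q⟩ - hpq
      rw [faceExponent_cone, if_neg, zpow_zero]
      simpa [Prod.ext_iff] using hpq
  · intro S _ hne
    unfold segWeight
    rw [if_neg]
    intro hS
    obtain ⟨s, hs⟩ := Finset.nonempty_iff_ne_empty.2 hne
    have := exists_closed_of_mem (isStepSurface_cone n₀ i₀ j₀) (fun _ _ => le_rfl) hS hs
    omega
  · simp

/-! ### Raising the completed surface to the cone. -/

/-- The surface agreeing with `h` inside the cone and with the cone outside. -/
def completion (h : ℤ → ℤ → ℤ) (n₀ i₀ j₀ : ℤ) : ℤ → ℤ → ℤ :=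
  fun i j => min (h i j) (coneHeight n₀ i₀ j₀ i j)

theorem completion_le (h : ℤ → ℤ → ℤ) (n₀ i₀ j₀ i j : ℤ) :
    completion h n₀ i₀ j₀ i j ≤ coneHeight n₀ i₀ j₀ i j := min_le_right _ _

/-- The points of the surface `g` lie in the lattice. -/
def IsEvenSurface (g : ℤ → ℤ → ℤ) : Prop :=
  ∀ i j, (g i j - i - j) % 2 = 0

theorem isEvenSurface_cone {n₀ i₀ j₀ : ℤ} (hn : (n₀ - i₀ - j₀) % 2 = 0) :
    IsEvenSurface (coneHeight n₀ i₀ j₀) := by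
  intro i j
  unfold coneHeight
  have := abs_choice (i - i₀)
  have := abs_choice (j - j₀)
  omega

/-- Both surfaces have the same parity at each point, so they cannot cross strictly between two
neighbouring faces, and their minimum still moves by exactly one. -/
theorem isStepSurface_completion {h : ℤ → ℤ → ℤ} (hs : IsStepSurface h) (he : IsEvenSurface h)
    {n₀ i₀ j₀ : ℤ} (hn : (n₀ - i₀ - j₀) % 2 = 0) : IsStepSurface (completion h n₀ i₀ j₀) := by
  intro i j
  have := isStepSurface_cone n₀ i₀ j₀ i j
  have := isEvenSurface_cone hn i j
  have := hs i j
  have := he i j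
  unfold completion
  omega

theorem IsStepSurface.isSurfaceMin {g : ℤ → ℤ → ℤ} (hg : IsStepSurface g) {i j : ℤ}
    (hE : g (i + 1) j = g i j + 1) (hN : g i (j + 1) = g i j + 1)
    (hW : g (i - 1) j = g i j + 1) (hS : g i (j - 1) = g i j + 1) : IsSurfaceMin g i j := by
  have h₁ := (hg i (j + 1)).1
  have h₂ := (hg (i - 1) (j + 1)).1
  have h₃ := (hg (i - 1) (j - 1)).1
  have h₄ := (hg i (j - 1)).1
  rw [sub_add_cancel] at h₂ h₃
  constructor <;> omega

theorem isStepSurface_raiseAt {h : ℤ → ℤ → ℤ} (hs : IsStepSurface h) {i j : ℤ}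
    (hE : h (i + 1) j = h i j + 1) (hN : h i (j + 1) = h i j + 1)
    (hW : h (i - 1) j = h i j + 1) (hS : h i (j - 1) = h i j + 1) :
    IsStepSurface (raiseAt h i j) := by
  intro p q
  have := hs p q
  unfold raiseAt
  by_cases h₁ : p = i ∧ q = j
  · obtain ⟨rfl, rfl⟩ := h₁
    simp [hE, hN]
    omega
  by_cases h₂ : p + 1 = i ∧ q = j
  · obtain ⟨rfl, rfl⟩ := h₂
    rw [add_sub_cancel_right] at hW
    simp
    omega
  by_cases h₃ : p = i ∧ q + 1 = j
  · obtain ⟨rfl, rfl⟩ := h₃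
    rw [add_sub_cancel_right] at hS
    simp
    omega
  rw [if_neg h₁, if_neg h₂, if_neg h₃]
  exact this

/-- Here `a`, `a'` are surface heights and `c`, `c'` cone heights at a lowest closed face and a
neighbour. A closed neighbour is not lower, so it is one higher. For an open one, parity gives `a +
2 ≤ c`, hence `a' ≥ c' ≥ a + 1`, with equality throughout. In both cases the completion agrees with
the surface there. -/
theorem neighbour_of_min {a c a' c' : ℤ} (hlt : a < c) (hp : (c - a) % 2 = 0)
    (ha : a' = a + 1 ∨ a' = a - 1) (hc : c' = c + 1 ∨ c' = c - 1) (hm : a' < c' → a ≤ a') :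
    a' = a + 1 ∧ a' ≤ c' := by
  by_cases h : a' < c'
  · have := hm h
    omega
  · omega

/-- The partition sum of the completed surface solves the octahedron recurrence. -/
theorem partitionSum_completion {f : ℤ → ℤ → ℤ → ℚ} (hf0 : ∀ n i j, f n i j ≠ 0)
    (hf : ∀ n i j, (n - i - j) % 2 = 0 → f n i j * f (n - 2) i j =
      f (n - 1) i (j + 1) * f (n - 1) i (j - 1) + f (n - 1) (i + 1) j * f (n - 1) (i - 1) j)
    {n₀ i₀ j₀ : ℤ} (hn : (n₀ - i₀ - j₀) % 2 = 0) {B F : Finset (ℤ × ℤ)}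
    {E : Finset (Bool × ℤ × ℤ)}
    (hE : ∀ i j, (i, j) ∈ B →
      {(false, i, j), (true, i, j), (false, i - 1, j), (true, i, j - 1)} ⊆ E)
    (hF : ∀ i j, (i, j) ∈ B → {(i, j), (i + 1, j), (i, j + 1), (i - 1, j), (i, j - 1)} ⊆ F)
    (hF₀ : (i₀, j₀) ∈ F) (h : ℤ → ℤ → ℤ) (hs : IsStepSurface h) (he : IsEvenSurface h)
    (hB : ∀ i j, h i j < coneHeight n₀ i₀ j₀ i j → (i, j) ∈ B) (h₀ : h i₀ j₀ ≤ n₀) :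
    partitionSum (completion h n₀ i₀ j₀) (fun i j => f (h i j) i j) E F = f n₀ i₀ j₀ := by
  -- Induction on the total gap below the cone. Raising only shrinks the set of closed faces, so
  -- `B`, `E` and `F` stay fixed.
  induction hm : ∑ b ∈ B, (coneHeight n₀ i₀ j₀ b.1 b.2 - h b.1 b.2).toNat
    using Nat.strong_induction_on generalizing h with
  | _ m ih =>
  subst hm
  by_cases hC : ∃ b ∈ B, h b.1 b.2 < coneHeight n₀ i₀ j₀ b.1 b.2
  -- A lowest closed face is a strict local minimum of the completion, so urban renewal applies
  -- there.
  · obtain ⟨⟨i, j⟩, hb, hmin⟩ := (B.filter fun b => h b.1 b.2 < coneHeight n₀ i₀ j₀ b.1 b.2)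
      |>.exists_min_image (fun b => h b.1 b.2)
        (by obtain ⟨b, hb, hb'⟩ := hC; exact ⟨b, Finset.mem_filter.2 ⟨hb, hb'⟩⟩)
    obtain ⟨hbB, hlt⟩ := Finset.mem_filter.1 hb
    dsimp only at hlt hmin
    have hmin' : ∀ p q, h p q < coneHeight n₀ i₀ j₀ p q → h i j ≤ h p q := fun p q hpq =>
      hmin (p, q) (Finset.mem_filter.2 ⟨hB p q hpq, hpq⟩)
    have cs := isStepSurface_cone n₀ i₀ j₀
    have ce := isEvenSurface_cone hn
    have hp : (coneHeight n₀ i₀ j₀ i j - h i j) % 2 = 0 := by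
      have := ce i j; have := he i j; omega
    have sW := (hs (i - 1) j).1
    have sS := (hs i (j - 1)).2
    have tW := (cs (i - 1) j).1
    have tS := (cs i (j - 1)).2
    rw [sub_add_cancel] at sW tW sS tS
    have hE' := neighbour_of_min hlt hp (hs i j).1 (cs i j).1 (hmin' (i + 1) j)
    have hN' := neighbour_of_min hlt hp (hs i j).2 (cs i j).2 (hmin' i (j + 1))
    have hW' := neighbour_of_min hlt hp (by clear * - sW; omega) (by clear * - tW; omega)
      (hmin' (i - 1) j)
    have hS' := neighbour_of_min hlt hp (by clear * - sS; omega) (by clear * - tS; omega)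
      (hmin' i (j - 1))
    have hcC : completion h n₀ i₀ j₀ i j = h i j := min_eq_left hlt.le
    have hcE : completion h n₀ i₀ j₀ (i + 1) j = h (i + 1) j := min_eq_left hE'.2
    have hcN : completion h n₀ i₀ j₀ i (j + 1) = h i (j + 1) := min_eq_left hN'.2
    have hcW : completion h n₀ i₀ j₀ (i - 1) j = h (i - 1) j := min_eq_left hW'.2
    have hcS : completion h n₀ i₀ j₀ i (j - 1) = h i (j - 1) := min_eq_left hS'.2
    have hM : IsSurfaceMin (completion h n₀ i₀ j₀) i j :=
      (isStepSurface_completion hs he hn).isSurfaceMin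
        (by rw [hcE, hcC, hE'.1]) (by rw [hcN, hcC, hN'.1]) (by rw [hcW, hcC, hW'.1])
        (by rw [hcS, hcC, hS'.1])
    -- By parity the gap at a closed face is at least `2`, so the raised value is still at most the
    -- cone.
    have hr : completion (raiseAt h i j) n₀ i₀ j₀ = raiseAt (completion h n₀ i₀ j₀) i j := by
      funext p q
      by_cases hpq : p = i ∧ q = j
      · obtain ⟨rfl, rfl⟩ := hpq
        rw [raiseAt_self, hcC]
        unfold completion
        rw [raiseAt_self]
        clear * - hlt hp
        omega
      · rw [raiseAt_of_ne _ _ _ _ _ hpq]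
        unfold completion
        rw [raiseAt_of_ne _ _ _ _ _ hpq]
    have hge : ∀ p q, h p q ≤ raiseAt h i j p q := by
      intro p q
      unfold raiseAt
      split_ifs with hpq
      · obtain ⟨rfl, rfl⟩ := hpq
        omega
      · rfl
    rw [partitionSum_raiseAt (x' := fun p q => f (raiseAt h i j p q) p q) hM
      (fun _ _ => hf0 _ _ _) (fun _ _ => hf0 _ _ _)
      (fun p q hpq => by rw [raiseAt_of_ne h i j p q hpq]) ?_ (hF i j hbB) (hE i j hbB), ← hr]
    · refine ih _ ?_ _ (isStepSurface_raiseAt hs hE'.1 hN'.1 hW'.1 hS'.1) ?_ ?_ ?_ rfl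
      · refine Finset.sum_lt_sum (fun b _ => ?_) ⟨(i, j), hbB, ?_⟩
        · have := hge b.1 b.2
          clear * - this
          omega
        · dsimp only
          rw [raiseAt_self]
          clear * - hlt
          omega
      · intro p q
        unfold raiseAt
        split_ifs with hpq
        · obtain ⟨rfl, rfl⟩ := hpq
          have := he p q
          clear * - this
          omega
        · exact he p q
      · exact fun p q hpq => hB p q ((hge p q).trans_lt hpq)
      · unfold raiseAt
        split_ifs with hpq
        · obtain ⟨rfl, rfl⟩ := hpq
          simp only [coneHeight, sub_self, abs_zero] at hlt hp
          clear * - hlt hp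
          omega
        · exact h₀
    · have := hf (h i j + 2) i j (by have := he i j; clear * - this; omega)
      rw [show h i j + 2 - 2 = h i j by ring, show h i j + 2 - 1 = h i j + 1 by ring] at this
      rw [raiseAt_self, hE'.1, hN'.1, hW'.1, hS'.1, this]
  -- No closed face is left. The invariant `h i₀ j₀ ≤ n₀` then makes the apex variable exactly `f n₀
  -- i₀ j₀`.
  · have hge : ∀ i j, coneHeight n₀ i₀ j₀ i j ≤ h i j := by
      intro i j
      by_contra hlt
      rw [not_le] at hlt
      exact hC ⟨_, hB i j hlt, hlt⟩
    have hc : completion h n₀ i₀ j₀ = coneHeight n₀ i₀ j₀ := by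
      funext i j
      exact min_eq_right (hge i j)
    have := hge i₀ j₀
    simp only [coneHeight, sub_self, abs_zero, sub_zero] at this
    rw [hc, partitionSum_cone _ _ hF₀, le_antisymm h₀ this]

/-! ### Vertices of the infinite graph, indexed by the sides of unit squares. -/

/-- The vertex of the square at `(i, j)` lying on its bottom side, as a set of faces. -/
def bottomSet (h : ℤ → ℤ → ℤ) (i j : ℤ) : Finset (ℤ × ℤ) :=
  {(i, j), (i + 1, j)} ∪ ((if h i j = h (i + 1) (j + 1) then {(i + 1, j + 1)} else ∅) ∪
    (if h (i + 1) j = h i (j + 1) then {(i, j + 1)} else ∅))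

/-- The vertex of the square at `(i, j)` lying on its top side, as a set of faces. -/
def topSet (h : ℤ → ℤ → ℤ) (i j : ℤ) : Finset (ℤ × ℤ) :=
  {(i, j + 1), (i + 1, j + 1)} ∪ ((if h i j = h (i + 1) (j + 1) then {(i, j)} else ∅) ∪
    (if h (i + 1) j = h i (j + 1) then {(i + 1, j)} else ∅))

/-- The vertex of the square at `(i, j)` lying on its left side, as a set of faces. -/
def leftSet (h : ℤ → ℤ → ℤ) (i j : ℤ) : Finset (ℤ × ℤ) :=
  {(i, j), (i, j + 1)} ∪ ((if h i j = h (i + 1) (j + 1) then {(i + 1, j + 1)} else ∅) ∪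
    (if h (i + 1) j = h i (j + 1) then {(i + 1, j)} else ∅))

/-- The vertex of the square at `(i, j)` lying on its right side, as a set of faces. -/
def rightSet (h : ℤ → ℤ → ℤ) (i j : ℤ) : Finset (ℤ × ℤ) :=
  {(i + 1, j), (i + 1, j + 1)} ∪ ((if h i j = h (i + 1) (j + 1) then {(i, j)} else ∅) ∪
    (if h (i + 1) j = h i (j + 1) then {(i, j + 1)} else ∅))

section Membership

variable {h : ℤ → ℤ → ℤ} {i j x y : ℤ}

theorem mem_bottomSet : (x, y) ∈ bottomSet h i j ↔ (x = i ∧ y = j) ∨ (x = i + 1 ∧ y = j) ∨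
    (h i j = h (i + 1) (j + 1) ∧ x = i + 1 ∧ y = j + 1) ∨
    (h (i + 1) j = h i (j + 1) ∧ x = i ∧ y = j + 1) := by
  unfold bottomSet
  split_ifs <;> simp [*] <;> tauto

theorem mem_topSet : (x, y) ∈ topSet h i j ↔ (x = i ∧ y = j + 1) ∨ (x = i + 1 ∧ y = j + 1) ∨
    (h i j = h (i + 1) (j + 1) ∧ x = i ∧ y = j) ∨
    (h (i + 1) j = h i (j + 1) ∧ x = i + 1 ∧ y = j) := by
  unfold topSet
  split_ifs <;> simp [*] <;> tauto

theorem mem_leftSet : (x, y) ∈ leftSet h i j ↔ (x = i ∧ y = j) ∨ (x = i ∧ y = j + 1) ∨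
    (h i j = h (i + 1) (j + 1) ∧ x = i + 1 ∧ y = j + 1) ∨
    (h (i + 1) j = h i (j + 1) ∧ x = i + 1 ∧ y = j) := by
  unfold leftSet
  split_ifs <;> simp [*] <;> tauto

theorem mem_rightSet : (x, y) ∈ rightSet h i j ↔ (x = i + 1 ∧ y = j) ∨
    (x = i + 1 ∧ y = j + 1) ∨ (h i j = h (i + 1) (j + 1) ∧ x = i ∧ y = j) ∨
    (h (i + 1) j = h i (j + 1) ∧ x = i ∧ y = j + 1) := by
  unfold rightSet
  split_ifs <;> simp [*] <;> tauto

theorem bottomSet_eq_topSet_iff : bottomSet h i j = topSet h i j ↔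
    h i j = h (i + 1) (j + 1) ∧ h (i + 1) j = h i (j + 1) := by
  constructor
  · intro H
    have h₁ := (Finset.ext_iff.1 H (i, j)).1 (mem_bottomSet.2 (by omega))
    have h₂ := (Finset.ext_iff.1 H (i + 1, j)).1 (mem_bottomSet.2 (by omega))
    rw [mem_topSet] at h₁ h₂
    omega
  · intro H
    ext ⟨x, y⟩
    rw [mem_bottomSet, mem_topSet]
    tauto

theorem bottomSet_eq_leftSet_iff : bottomSet h i j = leftSet h i j ↔
    h (i + 1) j = h i (j + 1) := by
  constructor
  · intro H
    have h₂ := (Finset.ext_iff.1 H (i + 1, j)).1 (mem_bottomSet.2 (by omega))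
    rw [mem_leftSet] at h₂
    omega
  · intro H
    ext ⟨x, y⟩
    rw [mem_bottomSet, mem_leftSet]
    tauto

theorem bottomSet_eq_rightSet_iff : bottomSet h i j = rightSet h i j ↔
    h i j = h (i + 1) (j + 1) := by
  constructor
  · intro H
    have h₂ := (Finset.ext_iff.1 H (i, j)).1 (mem_bottomSet.2 (by omega))
    rw [mem_rightSet] at h₂
    omega
  · intro H
    ext ⟨x, y⟩
    rw [mem_bottomSet, mem_rightSet]
    tauto

theorem topSet_eq_leftSet_iff : topSet h i j = leftSet h i j ↔
    h i j = h (i + 1) (j + 1) := by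
  constructor
  · intro H
    have h₂ := (Finset.ext_iff.1 H (i + 1, j + 1)).1 (mem_topSet.2 (by omega))
    rw [mem_leftSet] at h₂
    omega
  · intro H
    ext ⟨x, y⟩
    rw [mem_topSet, mem_leftSet]
    tauto

theorem topSet_eq_rightSet_iff : topSet h i j = rightSet h i j ↔
    h (i + 1) j = h i (j + 1) := by
  constructor
  · intro H
    have h₂ := (Finset.ext_iff.1 H (i, j + 1)).1 (mem_topSet.2 (by omega))
    rw [mem_rightSet] at h₂
    omega
  · intro H
    ext ⟨x, y⟩
    rw [mem_topSet, mem_rightSet]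
    tauto

end Membership

/-- One of the diagonal pairs of a unit square does not border. -/
theorem IsStepSurface.diag {h : ℤ → ℤ → ℤ} (hs : IsStepSurface h) (i j : ℤ) :
    h i j = h (i + 1) (j + 1) ∨ h (i + 1) j = h i (j + 1) := by
  have := hs i j
  have := (hs i (j + 1)).1
  have := (hs (i + 1) j).2
  omega

theorem isGraphVertex_bottomSet {h : ℤ → ℤ → ℤ} (hs : IsStepSurface h) (i j : ℤ) :
    IsGraphVertex h (bottomSet h i j) := by
  refine ⟨i, j, ?_⟩
  have := hs.diag i j
  by_cases hp : h i j = h (i + 1) (j + 1) <;> by_cases hq : h (i + 1) j = h i (j + 1)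
  · refine .inl ⟨hp, hq, ?_⟩
    ext ⟨x, y⟩
    rw [mem_bottomSet]
    simp
    omega
  · refine .inr (.inl ⟨hq, .inl ?_⟩)
    ext ⟨x, y⟩
    rw [mem_bottomSet]
    simp
    omega
  · refine .inr (.inr ⟨hp, .inl ?_⟩)
    ext ⟨x, y⟩
    rw [mem_bottomSet]
    simp
    omega
  · tauto

theorem isGraphVertex_topSet {h : ℤ → ℤ → ℤ} (hs : IsStepSurface h) (i j : ℤ) :
    IsGraphVertex h (topSet h i j) := by
  refine ⟨i, j, ?_⟩
  have := hs.diag i j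
  by_cases hp : h i j = h (i + 1) (j + 1) <;> by_cases hq : h (i + 1) j = h i (j + 1)
  · refine .inl ⟨hp, hq, ?_⟩
    ext ⟨x, y⟩
    rw [mem_topSet]
    simp
    omega
  · refine .inr (.inl ⟨hq, .inr ?_⟩)
    ext ⟨x, y⟩
    rw [mem_topSet]
    simp
    omega
  · refine .inr (.inr ⟨hp, .inr ?_⟩)
    ext ⟨x, y⟩
    rw [mem_topSet]
    simp
    omega
  · tauto

theorem IsGraphVertex.eq_bottomSet_or_topSet {h : ℤ → ℤ → ℤ} (hs : IsStepSurface h)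
    {v : Finset (ℤ × ℤ)} (hv : IsGraphVertex h v) :
    ∃ i j, v = bottomSet h i j ∨ v = topSet h i j := by
  obtain ⟨i, j, hv⟩ := hv
  refine ⟨i, j, ?_⟩
  have := hs.diag i j
  rcases hv with ⟨hp, hq, rfl⟩ | ⟨hq, rfl | rfl⟩ | ⟨hp, rfl | rfl⟩
  · left; ext ⟨x, y⟩; rw [mem_bottomSet]; simp; omega
  · left; ext ⟨x, y⟩; rw [mem_bottomSet]; simp; omega
  · right; ext ⟨x, y⟩; rw [mem_topSet]; simp; omega
  · left; ext ⟨x, y⟩; rw [mem_bottomSet]; simp; omega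
  · right; ext ⟨x, y⟩; rw [mem_topSet]; simp; omega

theorem leftSet_eq {h : ℤ → ℤ → ℤ} (hs : IsStepSurface h) (i j : ℤ) :
    leftSet h i j = bottomSet h i j ∨ leftSet h i j = topSet h i j := by
  rcases hs.diag i j with hp | hq
  · exact .inr (topSet_eq_leftSet_iff.2 hp).symm
  · exact .inl (bottomSet_eq_leftSet_iff.2 hq).symm

theorem rightSet_eq {h : ℤ → ℤ → ℤ} (hs : IsStepSurface h) (i j : ℤ) :
    rightSet h i j = bottomSet h i j ∨ rightSet h i j = topSet h i j := by
  rcases hs.diag i j with hp | hq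
  · exact .inl (bottomSet_eq_rightSet_iff.2 hp).symm
  · exact .inr (topSet_eq_rightSet_iff.2 hq).symm

section Vertices

variable {h : ℤ → ℤ → ℤ}

/-- The vertex of the infinite graph on the bottom side of the square at `(i, j)`. -/
def bottomVertex (hs : IsStepSurface h) (i j : ℤ) : GraphVertex h :=
  ⟨bottomSet h i j, isGraphVertex_bottomSet hs i j⟩

/-- The vertex of the infinite graph on the top side of the square at `(i, j)`. -/
def topVertex (hs : IsStepSurface h) (i j : ℤ) : GraphVertex h :=
  ⟨topSet h i j, isGraphVertex_topSet hs i j⟩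

/-- The vertex of the infinite graph on the left side of the square at `(i, j)`. -/
def leftVertex (hs : IsStepSurface h) (i j : ℤ) : GraphVertex h :=
  ⟨leftSet h i j, by
    rcases leftSet_eq hs i j with H | H <;> rw [H]
    exacts [isGraphVertex_bottomSet hs i j, isGraphVertex_topSet hs i j]⟩

/-- The vertex of the infinite graph on the right side of the square at `(i, j)`. -/
def rightVertex (hs : IsStepSurface h) (i j : ℤ) : GraphVertex h :=
  ⟨rightSet h i j, by
    rcases rightSet_eq hs i j with H | H <;> rw [H]
    exacts [isGraphVertex_bottomSet hs i j, isGraphVertex_topSet hs i j]⟩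

variable (hs : IsStepSurface h) {i j : ℤ}

theorem bottomVertex_eq_topVertex_iff : bottomVertex hs i j = topVertex hs i j ↔
    h i j = h (i + 1) (j + 1) ∧ h (i + 1) j = h i (j + 1) :=
  Subtype.ext_iff.trans bottomSet_eq_topSet_iff

theorem bottomVertex_eq_leftVertex_iff : bottomVertex hs i j = leftVertex hs i j ↔
    h (i + 1) j = h i (j + 1) :=
  Subtype.ext_iff.trans bottomSet_eq_leftSet_iff

theorem bottomVertex_eq_rightVertex_iff : bottomVertex hs i j = rightVertex hs i j ↔
    h i j = h (i + 1) (j + 1) :=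
  Subtype.ext_iff.trans bottomSet_eq_rightSet_iff

theorem topVertex_eq_leftVertex_iff : topVertex hs i j = leftVertex hs i j ↔
    h i j = h (i + 1) (j + 1) :=
  Subtype.ext_iff.trans topSet_eq_leftSet_iff

theorem topVertex_eq_rightVertex_iff : topVertex hs i j = rightVertex hs i j ↔
    h (i + 1) j = h i (j + 1) :=
  Subtype.ext_iff.trans topSet_eq_rightSet_iff

theorem GraphVertex.eq_bottom_or_top (v : GraphVertex h) :
    ∃ i j, v = bottomVertex hs i j ∨ v = topVertex hs i j := by
  obtain ⟨i, j, H⟩ := v.2.eq_bottomSet_or_topSet hs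
  exact ⟨i, j, H.imp Subtype.ext Subtype.ext⟩

theorem leftVertex_eq (i j : ℤ) :
    leftVertex hs i j = bottomVertex hs i j ∨ leftVertex hs i j = topVertex hs i j :=
  (leftSet_eq hs i j).imp Subtype.ext Subtype.ext

theorem rightVertex_eq (i j : ℤ) :
    rightVertex hs i j = bottomVertex hs i j ∨ rightVertex hs i j = topVertex hs i j :=
  (rightSet_eq hs i j).imp Subtype.ext Subtype.ext

/-- The vertex `v` lies in the square at `(i, j)`. -/
def InSquare (v : GraphVertex h) (i j : ℤ) : Prop :=
  v = bottomVertex hs i j ∨ v = topVertex hs i j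

theorem inSquare_bottom : InSquare hs (bottomVertex hs i j) i j := .inl rfl

theorem inSquare_top : InSquare hs (topVertex hs i j) i j := .inr rfl

theorem inSquare_left : InSquare hs (leftVertex hs i j) i j := leftVertex_eq hs i j

theorem inSquare_right : InSquare hs (rightVertex hs i j) i j := rightVertex_eq hs i j

theorem InSquare.bounds {v : GraphVertex h} (hv : InSquare hs v i j) {x y : ℤ}
    (hxy : (x, y) ∈ v.1) : (x = i ∨ x = i + 1) ∧ (y = j ∨ y = j + 1) := by
  rcases hv with rfl | rfl
  · have := mem_bottomSet.1 hxy; omega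
  · have := mem_topSet.1 hxy; omega

/-- A vertex meets both columns and both rows of its square, so its set of faces determines the
square; this yields `InSquare.unique`. -/
theorem InSquare.exists_mem {v : GraphVertex h} (hv : InSquare hs v i j) :
    (∃ y y', (i, y) ∈ v.1 ∧ (i + 1, y') ∈ v.1) ∧ ∃ x x', (x, j) ∈ v.1 ∧ (x', j + 1) ∈ v.1 := by
  have hd := hs.diag i j
  rcases hv with rfl | rfl
  · refine ⟨⟨j, j, mem_bottomSet.2 (by omega), mem_bottomSet.2 (by omega)⟩, ?_⟩
    rcases hd with hd | hd
    · exact ⟨i, i + 1, mem_bottomSet.2 (by omega), mem_bottomSet.2 (by omega)⟩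
    · exact ⟨i, i, mem_bottomSet.2 (by omega), mem_bottomSet.2 (by omega)⟩
  · refine ⟨⟨j + 1, j + 1, mem_topSet.2 (by omega), mem_topSet.2 (by omega)⟩, ?_⟩
    rcases hd with hd | hd
    · exact ⟨i, i, mem_topSet.2 (by omega), mem_topSet.2 (by omega)⟩
    · exact ⟨i + 1, i, mem_topSet.2 (by omega), mem_topSet.2 (by omega)⟩

theorem InSquare.unique {v : GraphVertex h} {p q : ℤ} (hv : InSquare hs v i j)
    (hv' : InSquare hs v p q) : i = p ∧ j = q := by
  obtain ⟨⟨y, y', h₁, h₂⟩, x, x', h₃, h₄⟩ := hv.exists_mem hs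
  have b₁ := hv'.bounds hs h₁
  have b₂ := hv'.bounds hs h₂
  have b₃ := hv'.bounds hs h₃
  have b₄ := hv'.bounds hs h₄
  omega

theorem InSquare.unique_of_eq {v w : GraphVertex h} {p q : ℤ} (hvw : v = w)
    (hv : InSquare hs v i j) (hw : InSquare hs w p q) : i = p ∧ j = q :=
  hv.unique hs (hvw ▸ hw)

theorem eq_of_mem_horizontal {v : GraphVertex h} (h₁ : (i, j) ∈ v.1) (h₂ : (i + 1, j) ∈ v.1) :
    v = bottomVertex hs i j ∨ v = topVertex hs i (j - 1) := by
  obtain ⟨p, q, rfl | rfl⟩ := v.eq_bottom_or_top hs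
  · have m₁ := mem_bottomSet.1 h₁
    have m₂ := mem_bottomSet.1 h₂
    obtain ⟨rfl, rfl⟩ | ⟨rfl, rfl, hp⟩ : (p = i ∧ q = j) ∨ (p = i ∧ q = j - 1 ∧
        (h p q = h (p + 1) (q + 1) ∧ h (p + 1) q = h p (q + 1))) := by omega
    · exact .inl rfl
    · exact .inr ((bottomVertex_eq_topVertex_iff hs).2 hp)
  · have m₁ := mem_topSet.1 h₁
    have m₂ := mem_topSet.1 h₂
    obtain ⟨rfl, rfl⟩ | ⟨rfl, rfl, hp⟩ : (p = i ∧ q = j - 1) ∨ (p = i ∧ q = j ∧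
        (h p q = h (p + 1) (q + 1) ∧ h (p + 1) q = h p (q + 1))) := by omega
    · exact .inr rfl
    · exact .inl ((bottomVertex_eq_topVertex_iff hs).2 hp).symm

theorem eq_of_mem_vertical {v : GraphVertex h} (h₁ : (i, j) ∈ v.1) (h₂ : (i, j + 1) ∈ v.1) :
    v = leftVertex hs i j ∨ v = rightVertex hs (i - 1) j := by
  obtain ⟨p, q, rfl | rfl⟩ := v.eq_bottom_or_top hs
  · have m₁ := mem_bottomSet.1 h₁
    have m₂ := mem_bottomSet.1 h₂
    obtain ⟨rfl, rfl, hp⟩ | ⟨rfl, rfl, hp⟩ : (p = i ∧ q = j ∧ h (p + 1) q = h p (q + 1)) ∨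
        (p = i - 1 ∧ q = j ∧ h p q = h (p + 1) (q + 1)) := by omega
    · exact .inl ((bottomVertex_eq_leftVertex_iff hs).2 hp)
    · exact .inr ((bottomVertex_eq_rightVertex_iff hs).2 hp)
  · have m₁ := mem_topSet.1 h₁
    have m₂ := mem_topSet.1 h₂
    obtain ⟨rfl, rfl, hp⟩ | ⟨rfl, rfl, hp⟩ : (p = i ∧ q = j ∧ h p q = h (p + 1) (q + 1)) ∨
        (p = i - 1 ∧ q = j ∧ h (p + 1) q = h p (q + 1)) := by omega
    · exact .inl ((topVertex_eq_leftVertex_iff hs).2 hp)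
    · exact .inr ((topVertex_eq_rightVertex_iff hs).2 hp)

theorem inSquare_of_mem_main {v : GraphVertex h} (h₁ : (i, j) ∈ v.1)
    (h₂ : (i + 1, j + 1) ∈ v.1) : InSquare hs v i j := by
  obtain ⟨p, q, hv⟩ := v.eq_bottom_or_top hs
  have b₁ := InSquare.bounds hs hv h₁
  have b₂ := InSquare.bounds hs hv h₂
  obtain ⟨rfl, rfl⟩ : p = i ∧ q = j := by omega
  exact hv

theorem inSquare_of_mem_anti {v : GraphVertex h} (h₁ : (i + 1, j) ∈ v.1)
    (h₂ : (i, j + 1) ∈ v.1) : InSquare hs v i j := by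
  obtain ⟨p, q, hv⟩ := v.eq_bottom_or_top hs
  have b₁ := InSquare.bounds hs hv h₁
  have b₂ := InSquare.bounds hs hv h₂
  obtain ⟨rfl, rfl⟩ : p = i ∧ q = j := by omega
  exact hv

/-! ### Edges of the infinite graph and of its subgraphs. -/

/-- `x`, `y` are `a`, `b` in some order. -/
def IsPair {α : Type*} (x y a b : α) : Prop := (x = a ∧ y = b) ∨ (x = b ∧ y = a)

theorem isPair_of_ne {α : Type*} {x y a b : α} (hxy : x ≠ y) (hx : x = a ∨ x = b)
    (hy : y = a ∨ y = b) : IsPair x y a b := by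
  unfold IsPair
  rcases hx with rfl | rfl <;> rcases hy with rfl | rfl <;> simp_all

/-- The edges of the infinite graph are dual to segments or lie inside squares. -/
theorem EdgeSeparates.classify {v w : GraphVertex h} {f g : ℤ × ℤ}
    (H : EdgeSeparates h v w f g) :
    (∃ i j, IsPair v w (bottomVertex hs i j) (topVertex hs i (j - 1)) ∧
      IsPair f g (i, j) (i + 1, j)) ∨
    (∃ i j, IsPair v w (leftVertex hs i j) (rightVertex hs (i - 1) j) ∧
      IsPair f g (i, j) (i, j + 1)) ∨
    (∃ i j, IsPair v w (bottomVertex hs i j) (topVertex hs i j) ∧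
      ((h (i + 1) j ≠ h i (j + 1) ∧ IsPair f g (i, j) (i + 1, j + 1)) ∨
        (h i j ≠ h (i + 1) (j + 1) ∧ IsPair f g (i + 1, j) (i, j + 1)))) := by
  obtain ⟨hne, hb, fv, gv, fw, gw⟩ := H
  obtain ⟨p, q⟩ := f
  obtain ⟨r, s⟩ := g
  rcases hb with hb | ⟨hb₁, hb₂, hb⟩
  · unfold LatticeAdjacent at hb
    dsimp only at hb
    have c₁ := abs_choice (p - r)
    have c₂ := abs_choice (q - s)
    have c₃ := abs_nonneg (p - r)
    have c₄ := abs_nonneg (q - s)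
    obtain ⟨rfl, rfl⟩ | ⟨rfl, rfl⟩ | ⟨rfl, rfl⟩ | ⟨rfl, rfl⟩ : (r = p + 1 ∧ s = q) ∨
      (p = r + 1 ∧ s = q) ∨ (r = p ∧ s = q + 1) ∨ (r = p ∧ q = s + 1) := by omega
    · exact .inl ⟨p, s, isPair_of_ne hne (eq_of_mem_horizontal hs fv gv)
        (eq_of_mem_horizontal hs fw gw), .inl ⟨rfl, rfl⟩⟩
    · exact .inl ⟨r, s, isPair_of_ne hne (eq_of_mem_horizontal hs gv fv)
        (eq_of_mem_horizontal hs gw fw), .inr ⟨rfl, rfl⟩⟩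
    · exact .inr (.inl ⟨r, q, isPair_of_ne hne (eq_of_mem_vertical hs fv gv)
        (eq_of_mem_vertical hs fw gw), .inl ⟨rfl, rfl⟩⟩)
    · exact .inr (.inl ⟨r, s, isPair_of_ne hne (eq_of_mem_vertical hs gv fv)
        (eq_of_mem_vertical hs gw fw), .inr ⟨rfl, rfl⟩⟩)
  · dsimp only at hb₁ hb₂ hb
    have c₁ := abs_choice (p - r)
    have c₂ := abs_choice (q - s)
    obtain ⟨rfl, rfl⟩ | ⟨rfl, rfl⟩ | ⟨rfl, rfl⟩ | ⟨rfl, rfl⟩ : (r = p + 1 ∧ s = q + 1) ∨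
      (p = r + 1 ∧ q = s + 1) ∨ (p = r + 1 ∧ s = q + 1) ∨ (r = p + 1 ∧ q = s + 1) := by omega
    · exact .inr (.inr ⟨p, q, isPair_of_ne hne (inSquare_of_mem_main hs fv gv)
        (inSquare_of_mem_main hs fw gw), .inl ⟨hb.symm, .inl ⟨rfl, rfl⟩⟩⟩)
    · exact .inr (.inr ⟨r, s, isPair_of_ne hne (inSquare_of_mem_main hs gv fv)
        (inSquare_of_mem_main hs gw fw), .inl ⟨hb, .inr ⟨rfl, rfl⟩⟩⟩)
    · exact .inr (.inr ⟨r, q, isPair_of_ne hne (inSquare_of_mem_anti hs fv gv)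
        (inSquare_of_mem_anti hs fw gw), .inr ⟨hb.symm, .inl ⟨rfl, rfl⟩⟩⟩)
    · exact .inr (.inr ⟨p, s, isPair_of_ne hne (inSquare_of_mem_anti hs gv fv)
        (inSquare_of_mem_anti hs gw fw), .inr ⟨hb, .inr ⟨rfl, rfl⟩⟩⟩)

end Vertices

section SubgraphAdjacency

variable {h : ℤ → ℤ → ℤ} (hs : IsStepSurface h) (M : (infiniteGraph h).Subgraph)

/-- `M` contains the edge dual to the horizontal segment at `(i, j)`. -/
def HorizAdj (i j : ℤ) : Prop := M.Adj (bottomVertex hs i j) (topVertex hs i (j - 1))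

/-- `M` contains the edge dual to the vertical segment at `(i, j)`. -/
def VertAdj (i j : ℤ) : Prop := M.Adj (leftVertex hs i j) (rightVertex hs (i - 1) j)

/-- `M` contains the edge inside the square at `(i, j)`. -/
def WrenchAdj (i j : ℤ) : Prop := M.Adj (bottomVertex hs i j) (topVertex hs i j)

theorem subgraph_adj_iff {v w : GraphVertex h} : M.Adj v w ↔
    (∃ i j, HorizAdj hs M i j ∧ IsPair v w (bottomVertex hs i j) (topVertex hs i (j - 1))) ∨
    (∃ i j, VertAdj hs M i j ∧ IsPair v w (leftVertex hs i j) (rightVertex hs (i - 1) j)) ∨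
    (∃ i j, WrenchAdj hs M i j ∧ IsPair v w (bottomVertex hs i j) (topVertex hs i j)) := by
  constructor
  · intro H
    obtain ⟨f, g, hfg⟩ := M.adj_sub H
    rcases hfg.classify hs with ⟨i, j, hp, -⟩ | ⟨i, j, hp, -⟩ | ⟨i, j, hp, -⟩
    · refine .inl ⟨i, j, ?_, hp⟩
      obtain ⟨rfl, rfl⟩ | ⟨rfl, rfl⟩ := hp
      exacts [H, M.symm.symm _ _ H]
    · refine .inr (.inl ⟨i, j, ?_, hp⟩)
      obtain ⟨rfl, rfl⟩ | ⟨rfl, rfl⟩ := hp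
      exacts [H, M.symm.symm _ _ H]
    · refine .inr (.inr ⟨i, j, ?_, hp⟩)
      obtain ⟨rfl, rfl⟩ | ⟨rfl, rfl⟩ := hp
      exacts [H, M.symm.symm _ _ H]
  · rintro (⟨i, j, H, ⟨rfl, rfl⟩ | ⟨rfl, rfl⟩⟩ | ⟨i, j, H, ⟨rfl, rfl⟩ | ⟨rfl, rfl⟩⟩ |
      ⟨i, j, H, ⟨rfl, rfl⟩ | ⟨rfl, rfl⟩⟩)
    exacts [H, M.symm.symm _ _ H, H, M.symm.symm _ _ H, H, M.symm.symm _ _ H]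

theorem subgraph_ext {M N : (infiniteGraph h).Subgraph} (hv : M.verts = N.verts)
    (hH : ∀ i j, HorizAdj hs M i j ↔ HorizAdj hs N i j)
    (hV : ∀ i j, VertAdj hs M i j ↔ VertAdj hs N i j)
    (hW : ∀ i j, WrenchAdj hs M i j ↔ WrenchAdj hs N i j) : M = N := by
  refine SimpleGraph.Subgraph.ext hv ?_
  funext v w
  rw [eq_iff_iff, subgraph_adj_iff hs, subgraph_adj_iff hs]
  simp only [hH, hV, hW]

open Classical in
/-- The other end of the edge inside the square at `(i, j)`. -/
noncomputable def otherVertex (v : GraphVertex h) (i j : ℤ) : GraphVertex h :=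
  if v = bottomVertex hs i j then topVertex hs i j else bottomVertex hs i j

/-- The possible neighbours of a vertex `v` in the square at `(i, j)`. -/
noncomputable def neighbour (v : GraphVertex h) (i j : ℤ) : Fin 5 → GraphVertex h :=
  ![topVertex hs i (j - 1), bottomVertex hs i (j + 1), rightVertex hs (i - 1) j,
    leftVertex hs (i + 1) j, otherVertex hs v i j]

/-- `M` contains the edge from `v`, in the square at `(i, j)`, to its possible neighbours. -/
def NeighbourAdj (v : GraphVertex h) (i j : ℤ) : Fin 5 → Prop :=
  ![v = bottomVertex hs i j ∧ HorizAdj hs M i j, v = topVertex hs i j ∧ HorizAdj hs M i (j + 1),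
    v = leftVertex hs i j ∧ VertAdj hs M i j, v = rightVertex hs i j ∧ VertAdj hs M (i + 1) j,
    WrenchAdj hs M i j]

/-- The five candidates lie in five different squares: the one below, above, left, right, and the
square itself. Hence counting neighbours is the same as counting admissible indices. -/
theorem neighbour_injective (v : GraphVertex h) (i j : ℤ) :
    Function.Injective (neighbour hs v i j) := by
  have key : ∀ k, InSquare hs (neighbour hs v i j k)
      ((![i, i, i - 1, i + 1, i] : Fin 5 → ℤ) k) ((![j - 1, j + 1, j, j, j] : Fin 5 → ℤ) k) := by
    intro k
    fin_cases k
    · exact inSquare_top hs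
    · exact inSquare_bottom hs
    · exact inSquare_right hs
    · exact inSquare_left hs
    · change InSquare hs (otherVertex hs v i j) i j
      unfold otherVertex
      split_ifs
      exacts [inSquare_top hs, inSquare_bottom hs]
  intro k l hkl
  have := InSquare.unique_of_eq hs hkl (key k) (key l)
  fin_cases k <;> fin_cases l <;> simp at this ⊢ <;> omega

theorem adj_iff_neighbour {v w : GraphVertex h} {i j : ℤ} (hv : InSquare hs v i j) :
    M.Adj v w ↔ ∃ k, w = neighbour hs v i j k ∧ NeighbourAdj hs M v i j k := by
  have hW : WrenchAdj hs M i j → bottomVertex hs i j ≠ topVertex hs i j := fun H =>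
    (M.adj_sub H).ne
  have hF : ∀ P : Fin 5 → Prop, (∃ k, P k) ↔ P 0 ∨ P 1 ∨ P 2 ∨ P 3 ∨ P 4 := by
    intro P
    simp [Fin.exists_fin_succ]
  rw [hF]
  change _ ↔ (w = topVertex hs i (j - 1) ∧ v = bottomVertex hs i j ∧ HorizAdj hs M i j) ∨
    (w = bottomVertex hs i (j + 1) ∧ v = topVertex hs i j ∧ HorizAdj hs M i (j + 1)) ∨
    (w = rightVertex hs (i - 1) j ∧ v = leftVertex hs i j ∧ VertAdj hs M i j) ∨
    (w = leftVertex hs (i + 1) j ∧ v = rightVertex hs i j ∧ VertAdj hs M (i + 1) j) ∨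
    (w = otherVertex hs v i j ∧ WrenchAdj hs M i j)
  rw [subgraph_adj_iff hs]
  constructor
  · rintro (⟨p, q, H, ⟨hv', rfl⟩ | ⟨hv', rfl⟩⟩ | ⟨p, q, H, ⟨hv', rfl⟩ | ⟨hv', rfl⟩⟩ |
      ⟨p, q, H, ⟨hv', rfl⟩ | ⟨hv', rfl⟩⟩)
    · obtain ⟨rfl, rfl⟩ := InSquare.unique_of_eq hs hv' hv (inSquare_bottom hs)
      exact .inl ⟨rfl, hv', H⟩
    · obtain ⟨rfl, rfl⟩ := InSquare.unique_of_eq hs hv' hv (inSquare_top hs)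
      rw [sub_add_cancel]
      exact .inr (.inl ⟨rfl, hv', H⟩)
    · obtain ⟨rfl, rfl⟩ := InSquare.unique_of_eq hs hv' hv (inSquare_left hs)
      exact .inr (.inr (.inl ⟨rfl, hv', H⟩))
    · obtain ⟨rfl, rfl⟩ := InSquare.unique_of_eq hs hv' hv (inSquare_right hs)
      rw [sub_add_cancel]
      exact .inr (.inr (.inr (.inl ⟨rfl, hv', H⟩)))
    · obtain ⟨rfl, rfl⟩ := InSquare.unique_of_eq hs hv' hv (inSquare_bottom hs)
      exact .inr (.inr (.inr (.inr ⟨by rw [otherVertex, if_pos hv'], H⟩)))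
    · obtain ⟨rfl, rfl⟩ := InSquare.unique_of_eq hs hv' hv (inSquare_top hs)
      exact .inr (.inr (.inr (.inr ⟨by rw [otherVertex, if_neg (hv' ▸ (hW H).symm)], H⟩)))
  · rintro (⟨rfl, rfl, H⟩ | ⟨rfl, rfl, H⟩ | ⟨rfl, rfl, H⟩ | ⟨rfl, rfl, H⟩ | ⟨hw, H⟩)
    · exact .inl ⟨_, _, H, .inl ⟨rfl, rfl⟩⟩
    · exact .inl ⟨_, _, H, .inr ⟨by rw [add_sub_cancel_right], rfl⟩⟩
    · exact .inr (.inl ⟨_, _, H, .inl ⟨rfl, rfl⟩⟩)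
    · exact .inr (.inl ⟨_, _, H, .inr ⟨by rw [add_sub_cancel_right], rfl⟩⟩)
    · refine .inr (.inr ⟨i, j, H, ?_⟩)
      unfold otherVertex at hw
      rcases hv with rfl | rfl
      · rw [if_pos rfl] at hw
        exact .inl ⟨rfl, hw⟩
      · rw [if_neg (hW H).symm] at hw
        exact .inr ⟨rfl, hw⟩

theorem existsUnique_fin_five_iff (A : Fin 5 → Prop) [DecidablePred A] : (∃! k, A k) ↔
    (if A 0 then 1 else 0) + (if A 1 then 1 else 0) + (if A 2 then 1 else 0) +
      (if A 3 then 1 else 0) + (if A 4 then 1 else 0) = (1 : ℤ) := by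
  rw [Fintype.existsUnique_iff_card_one, Finset.card_filter, ← Nat.cast_inj (R := ℤ),
    Fin.sum_univ_five]
  push_cast
  rfl

/-- Turns the matching condition at a vertex into a condition on five indicators, hence into linear
arithmetic. -/
theorem existsUnique_adj_iff {v : GraphVertex h} {i j : ℤ} (hv : InSquare hs v i j) :
    (∃! w, M.Adj v w) ↔ ∃! k, NeighbourAdj hs M v i j k := by
  constructor
  · rintro ⟨w, hw, hu⟩
    obtain ⟨k, -, hk⟩ := (adj_iff_neighbour hs M hv).1 hw
    refine ⟨k, hk, fun l hl => neighbour_injective hs v i j ?_⟩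
    rw [hu _ ((adj_iff_neighbour hs M hv).2 ⟨k, rfl, hk⟩),
      hu _ ((adj_iff_neighbour hs M hv).2 ⟨l, rfl, hl⟩)]
  · rintro ⟨k, hk, hu⟩
    refine ⟨_, (adj_iff_neighbour hs M hv).2 ⟨k, rfl, hk⟩, fun w hw => ?_⟩
    obtain ⟨l, rfl, hl⟩ := (adj_iff_neighbour hs M hv).1 hw
    rw [hu l hl]

open Classical in
theorem existsUnique_adj_bottom_iff (i j : ℤ) : (∃! w, M.Adj (bottomVertex hs i j) w) ↔
    (if HorizAdj hs M i j then 1 else 0) +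
    (if h i j = h (i + 1) (j + 1) ∧ h (i + 1) j = h i (j + 1) then
      (if HorizAdj hs M i (j + 1) then 1 else 0) else 0) +
    (if h (i + 1) j = h i (j + 1) then (if VertAdj hs M i j then 1 else 0) else 0) +
    (if h i j = h (i + 1) (j + 1) then (if VertAdj hs M (i + 1) j then 1 else 0) else 0) +
    (if WrenchAdj hs M i j then 1 else 0) = (1 : ℤ) := by
  rw [existsUnique_adj_iff hs M (inSquare_bottom hs), existsUnique_fin_five_iff]
  simp only [NeighbourAdj, Matrix.cons_val, bottomVertex_eq_topVertex_iff,
    bottomVertex_eq_leftVertex_iff, bottomVertex_eq_rightVertex_iff, true_and, ite_and]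

open Classical in
theorem existsUnique_adj_top_iff (i j : ℤ) : (∃! w, M.Adj (topVertex hs i j) w) ↔
    (if h i j = h (i + 1) (j + 1) ∧ h (i + 1) j = h i (j + 1) then
      (if HorizAdj hs M i j then 1 else 0) else 0) +
    (if HorizAdj hs M i (j + 1) then 1 else 0) +
    (if h i j = h (i + 1) (j + 1) then (if VertAdj hs M i j then 1 else 0) else 0) +
    (if h (i + 1) j = h i (j + 1) then (if VertAdj hs M (i + 1) j then 1 else 0) else 0) +
    (if WrenchAdj hs M i j then 1 else 0) = (1 : ℤ) := by
  rw [existsUnique_adj_iff hs M (inSquare_top hs), existsUnique_fin_five_iff]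
  simp only [NeighbourAdj, Matrix.cons_val, eq_comm (a := topVertex hs i j)
    (b := bottomVertex hs i j), bottomVertex_eq_topVertex_iff,
    topVertex_eq_leftVertex_iff, topVertex_eq_rightVertex_iff, true_and, ite_and]

theorem exists_adj_bottom_iff (i j : ℤ) : (∃ w, M.Adj (bottomVertex hs i j) w) ↔
    HorizAdj hs M i j ∨ (h i j = h (i + 1) (j + 1) ∧ h (i + 1) j = h i (j + 1) ∧
      HorizAdj hs M i (j + 1)) ∨ (h (i + 1) j = h i (j + 1) ∧ VertAdj hs M i j) ∨
    (h i j = h (i + 1) (j + 1) ∧ VertAdj hs M (i + 1) j) ∨ WrenchAdj hs M i j := by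
  simp only [adj_iff_neighbour hs M (inSquare_bottom hs)]
  rw [exists_comm]
  simp only [exists_eq_left, Fin.exists_fin_succ, IsEmpty.exists_iff, or_false]
  change (bottomVertex hs i j = bottomVertex hs i j ∧ HorizAdj hs M i j) ∨
    (bottomVertex hs i j = topVertex hs i j ∧ HorizAdj hs M i (j + 1)) ∨
    (bottomVertex hs i j = leftVertex hs i j ∧ VertAdj hs M i j) ∨
    (bottomVertex hs i j = rightVertex hs i j ∧ VertAdj hs M (i + 1) j) ∨
    WrenchAdj hs M i j ↔ _
  simp only [bottomVertex_eq_topVertex_iff, bottomVertex_eq_leftVertex_iff,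
    bottomVertex_eq_rightVertex_iff, true_and, and_assoc]

theorem exists_adj_top_iff (i j : ℤ) : (∃ w, M.Adj (topVertex hs i j) w) ↔
    (h i j = h (i + 1) (j + 1) ∧ h (i + 1) j = h i (j + 1) ∧ HorizAdj hs M i j) ∨
      HorizAdj hs M i (j + 1) ∨ (h i j = h (i + 1) (j + 1) ∧ VertAdj hs M i j) ∨
    (h (i + 1) j = h i (j + 1) ∧ VertAdj hs M (i + 1) j) ∨ WrenchAdj hs M i j := by
  simp only [adj_iff_neighbour hs M (inSquare_top hs)]
  rw [exists_comm]
  simp only [exists_eq_left, Fin.exists_fin_succ, IsEmpty.exists_iff, or_false]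
  change (topVertex hs i j = bottomVertex hs i j ∧ HorizAdj hs M i j) ∨
    (topVertex hs i j = topVertex hs i j ∧ HorizAdj hs M i (j + 1)) ∨
    (topVertex hs i j = leftVertex hs i j ∧ VertAdj hs M i j) ∨
    (topVertex hs i j = rightVertex hs i j ∧ VertAdj hs M (i + 1) j) ∨
    WrenchAdj hs M i j ↔ _
  simp only [eq_comm (a := topVertex hs i j) (b := bottomVertex hs i j),
    bottomVertex_eq_topVertex_iff, topVertex_eq_leftVertex_iff,
    topVertex_eq_rightVertex_iff, true_and, and_assoc]

end SubgraphAdjacency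

/-! ### Edges of the finite crosses-and-wrenches graph. -/

section CrossesWrenches

variable {h : ℤ → ℤ → ℤ} (hs : IsStepSurface h) (n₀ i₀ j₀ : ℤ)

theorem horizAdj_iff (i j : ℤ) : HorizAdj hs (crossesWrenchesGraph h n₀ i₀ j₀) i j ↔
    h i j < coneHeight n₀ i₀ j₀ i j ∨ h (i + 1) j < coneHeight n₀ i₀ j₀ (i + 1) j := by
  constructor
  · rintro ⟨f, g, H, hc⟩
    have hcl : ∀ e : ℤ × ℤ, e ∈ bottomSet h i j → e ∈ topSet h i (j - 1) →
        IsClosedFace h n₀ i₀ j₀ e → h i j < coneHeight n₀ i₀ j₀ i j ∨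
          h (i + 1) j < coneHeight n₀ i₀ j₀ (i + 1) j := by
      rintro ⟨x, y⟩ h₁ h₂ hc
      unfold IsClosedFace at hc
      have h₁' := mem_bottomSet.1 h₁
      have h₂' := mem_topSet.1 h₂
      obtain ⟨rfl | rfl, rfl⟩ : (x = i ∨ x = i + 1) ∧ y = j := by omega
      exacts [.inl hc, .inr hc]
    rcases hc with hc | hc
    · exact hcl f H.2.2.1 H.2.2.2.2.1 hc
    · exact hcl g H.2.2.2.1 H.2.2.2.2.2 hc
  · intro hc
    refine ⟨(i, j), (i + 1, j), ⟨fun H => ?_, .inl ?_, mem_bottomSet.2 (by omega),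
      mem_bottomSet.2 (by omega), mem_topSet.2 (by omega), mem_topSet.2 (by omega)⟩, hc⟩
    · have := InSquare.unique_of_eq hs H (inSquare_bottom hs) (inSquare_top hs)
      omega
    · simp [LatticeAdjacent]

theorem vertAdj_iff (i j : ℤ) : VertAdj hs (crossesWrenchesGraph h n₀ i₀ j₀) i j ↔
    h i j < coneHeight n₀ i₀ j₀ i j ∨ h i (j + 1) < coneHeight n₀ i₀ j₀ i (j + 1) := by
  constructor
  · rintro ⟨f, g, H, hc⟩
    have hcl : ∀ e : ℤ × ℤ, e ∈ leftSet h i j → e ∈ rightSet h (i - 1) j →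
        IsClosedFace h n₀ i₀ j₀ e → h i j < coneHeight n₀ i₀ j₀ i j ∨
          h i (j + 1) < coneHeight n₀ i₀ j₀ i (j + 1) := by
      rintro ⟨x, y⟩ h₁ h₂ hc
      unfold IsClosedFace at hc
      have h₁' := mem_leftSet.1 h₁
      have h₂' := mem_rightSet.1 h₂
      obtain ⟨rfl, rfl | rfl⟩ : x = i ∧ (y = j ∨ y = j + 1) := by omega
      exacts [.inl hc, .inr hc]
    rcases hc with hc | hc
    · exact hcl f H.2.2.1 H.2.2.2.2.1 hc
    · exact hcl g H.2.2.2.1 H.2.2.2.2.2 hc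
  · intro hc
    refine ⟨(i, j), (i, j + 1), ⟨fun H => ?_, .inl ?_, mem_leftSet.2 (by omega),
      mem_leftSet.2 (by omega), mem_rightSet.2 (by omega), mem_rightSet.2 (by omega)⟩, hc⟩
    · have := InSquare.unique_of_eq hs H (inSquare_left hs) (inSquare_right hs)
      omega
    · simp [LatticeAdjacent]

theorem wrenchAdj_iff (i j : ℤ) : WrenchAdj hs (crossesWrenchesGraph h n₀ i₀ j₀) i j ↔
    (h (i + 1) j ≠ h i (j + 1) ∧ (h i j < coneHeight n₀ i₀ j₀ i j ∨
      h (i + 1) (j + 1) < coneHeight n₀ i₀ j₀ (i + 1) (j + 1))) ∨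
    (h i j ≠ h (i + 1) (j + 1) ∧ (h (i + 1) j < coneHeight n₀ i₀ j₀ (i + 1) j ∨
      h i (j + 1) < coneHeight n₀ i₀ j₀ i (j + 1))) := by
  constructor
  · rintro ⟨f, g, H, hc⟩
    have hne : ¬ (h i j = h (i + 1) (j + 1) ∧ h (i + 1) j = h i (j + 1)) :=
      fun hpq => H.1 ((bottomVertex_eq_topVertex_iff hs).2 hpq)
    have hd := hs.diag i j
    have hcl : ∀ e : ℤ × ℤ, e ∈ bottomSet h i j → e ∈ topSet h i j →
        IsClosedFace h n₀ i₀ j₀ e → (h (i + 1) j ≠ h i (j + 1) ∧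
        (h i j < coneHeight n₀ i₀ j₀ i j ∨
          h (i + 1) (j + 1) < coneHeight n₀ i₀ j₀ (i + 1) (j + 1))) ∨
        (h i j ≠ h (i + 1) (j + 1) ∧ (h (i + 1) j < coneHeight n₀ i₀ j₀ (i + 1) j ∨
          h i (j + 1) < coneHeight n₀ i₀ j₀ i (j + 1))) := by
      rintro ⟨x, y⟩ h₁ h₂ hc
      unfold IsClosedFace at hc
      have h₁' := mem_bottomSet.1 h₁
      have h₂' := mem_topSet.1 h₂
      obtain ⟨rfl, rfl, hq⟩ | ⟨rfl, rfl, hq⟩ | ⟨rfl, rfl, hq⟩ | ⟨rfl, rfl, hq⟩ :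
          (x = i ∧ y = j ∧ h (i + 1) j ≠ h i (j + 1)) ∨
          (x = i + 1 ∧ y = j + 1 ∧ h (i + 1) j ≠ h i (j + 1)) ∨
          (x = i + 1 ∧ y = j ∧ h i j ≠ h (i + 1) (j + 1)) ∨
          (x = i ∧ y = j + 1 ∧ h i j ≠ h (i + 1) (j + 1)) := by omega
      exacts [.inl ⟨hq, .inl hc⟩, .inl ⟨hq, .inr hc⟩, .inr ⟨hq, .inl hc⟩, .inr ⟨hq, .inr hc⟩]
    rcases hc with hc | hc
    · exact hcl f H.2.2.1 H.2.2.2.2.1 hc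
    · exact hcl g H.2.2.2.1 H.2.2.2.2.2 hc
  · have hd := hs.diag i j
    rintro (⟨hq, hc⟩ | ⟨hp, hc⟩)
    · refine ⟨(i, j), (i + 1, j + 1), ⟨fun H => ?_, .inr ⟨?_, ?_, hq.symm⟩,
        mem_bottomSet.2 (by omega), mem_bottomSet.2 (by omega), mem_topSet.2 (by omega),
        mem_topSet.2 (by omega)⟩, hc⟩
      · exact hq ((bottomVertex_eq_topVertex_iff hs).1 H).2
      · simp
      · simp
    · refine ⟨(i + 1, j), (i, j + 1), ⟨fun H => ?_, .inr ⟨?_, ?_, hp.symm⟩,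
        mem_bottomSet.2 (by omega), mem_bottomSet.2 (by omega), mem_topSet.2 (by omega),
        mem_topSet.2 (by omega)⟩, hc⟩
      · exact hp ((bottomVertex_eq_topVertex_iff hs).1 H).1
      · simp
      · simp

end CrossesWrenches

/-! ### Matchings correspond to valid sets of segments. -/

-- The content of one unit square, as pure arithmetic. `HA … HD` are surface heights and `CA … CD`
-- cone heights at the corners (lower left, lower right, upper left, upper right); `a a' b b'` are
-- the bottom, top, left and right sides, and `d` is the inner edge. On the left stand the matching
-- conditions at those vertices that belong to the finite graph; on the right, validity for the
-- completed surface and the forced value of `d`.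
set_option maxHeartbeats 2000000 in
theorem square_matching_iff {HA HB HC HD CA CB CC CD a a' b b' d : ℤ}
    (h₁ : HB = HA + 1 ∨ HB = HA - 1) (h₂ : HC = HA + 1 ∨ HC = HA - 1)
    (h₃ : HD = HC + 1 ∨ HD = HC - 1) (h₄ : HD = HB + 1 ∨ HD = HB - 1)
    (c₁ : CB = CA + 1 ∨ CB = CA - 1) (c₂ : CC = CA + 1 ∨ CC = CA - 1) (c₃ : CD = CB + CC - CA)
    (hp : (CA - HA) % 2 = 0) (ha : a = 0 ∨ a = 1) (ha' : a' = 0 ∨ a' = 1) (hb : b = 0 ∨ b = 1)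
    (hb' : b' = 0 ∨ b' = 1) (hd : d = 0 ∨ d = 1)
    (sa : a = 1 → HA < CA ∨ HB < CB) (sa' : a' = 1 → HC < CC ∨ HD < CD)
    (sb : b = 1 → HA < CA ∨ HC < CC) (sb' : b' = 1 → HB < CB ∨ HD < CD)
    (sd : d = 1 → (HB ≠ HC ∧ (HA < CA ∨ HD < CD)) ∨ (HA ≠ HD ∧ (HB < CB ∨ HC < CC))) :
    ((((HA < CA ∨ HB < CB) ∨ (HA = HD ∧ HB = HC ∧ (HC < CC ∨ HD < CD)) ∨
        (HB = HC ∧ (HA < CA ∨ HC < CC)) ∨ (HA = HD ∧ (HB < CB ∨ HD < CD)) ∨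
        ((HB ≠ HC ∧ (HA < CA ∨ HD < CD)) ∨ (HA ≠ HD ∧ (HB < CB ∨ HC < CC)))) →
      a + (if HA = HD ∧ HB = HC then a' else 0) + (if HB = HC then b else 0) +
        (if HA = HD then b' else 0) + d = 1) ∧
    (((HA = HD ∧ HB = HC ∧ (HA < CA ∨ HB < CB)) ∨ (HC < CC ∨ HD < CD) ∨
        (HA = HD ∧ (HA < CA ∨ HC < CC)) ∨ (HB = HC ∧ (HB < CB ∨ HD < CD)) ∨
        ((HB ≠ HC ∧ (HA < CA ∨ HD < CD)) ∨ (HA ≠ HD ∧ (HB < CB ∨ HC < CC)))) →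
      (if HA = HD ∧ HB = HC then a else 0) + a' + (if HA = HD then b else 0) +
        (if HB = HC then b' else 0) + d = 1)) ↔
    ((min HA CA = min HD CD ∧ min HB CB = min HC CC → a + a' + b + b' = 1) ∧
      (min HB CB ≠ min HC CC → a + b' = a' + b ∧ a + b' ≤ 1) ∧
      (min HA CA ≠ min HD CD → a + b = a' + b' ∧ a + b ≤ 1)) ∧
    (d = 1 ↔ ((HB ≠ HC ∧ (HA < CA ∨ HD < CD)) ∨ (HA ≠ HD ∧ (HB < CB ∨ HC < CC))) ∧
      a = 0 ∧ a' = 0 ∧ b = 0 ∧ b' = 0) := by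
  rcases c₁ with rfl | rfl <;> rcases c₂ with rfl | rfl <;> subst c₃ <;>
  rcases h₁ with rfl | rfl <;> rcases h₂ with rfl | rfl <;> rcases h₃ with rfl | rfl <;>
  first
  | (exfalso; omega)
  -- The gap between cone and surface is even and varies by at most `4` over a square. From `6` on,
  -- all corners are closed or all are open, which leaves five values to check separately.
  | (obtain hk | rfl | rfl | rfl | rfl | rfl | hk : CA ≤ HA - 6 ∨ CA = HA - 4 ∨ CA = HA - 2 ∨ CA = HA ∨
      CA = HA + 2 ∨ CA = HA + 4 ∨ HA + 6 ≤ CA := by omega) <;> grind (splits := 20)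

section Counting

variable {h : ℤ → ℤ → ℤ} (hs : IsStepSurface h) {n₀ i₀ j₀ : ℤ}

open Classical in
theorem isMatching_iff (he : IsEvenSurface h) (hn : (n₀ - i₀ - j₀) % 2 = 0)
    {M : (infiniteGraph h).Subgraph} (hM : M ≤ crossesWrenchesGraph h n₀ i₀ j₀)
    (hv : M.verts = (crossesWrenchesGraph h n₀ i₀ j₀).verts) :
    M.IsMatching ↔ ∀ i j,
      SquareValid (completion h n₀ i₀ j₀) (fun i j => if HorizAdj hs M i j then 1 else 0)
        (fun i j => if VertAdj hs M i j then 1 else 0) i j ∧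
      (WrenchAdj hs M i j ↔ WrenchAdj hs (crossesWrenchesGraph h n₀ i₀ j₀) i j ∧
        ¬ HorizAdj hs M i j ∧ ¬ HorizAdj hs M i (j + 1) ∧ ¬ VertAdj hs M i j ∧
        ¬ VertAdj hs M (i + 1) j) := by
  have step₁ : M.IsMatching ↔ ∀ i j,
      ((∃ w, (crossesWrenchesGraph h n₀ i₀ j₀).Adj (bottomVertex hs i j) w) →
        ∃! w, M.Adj (bottomVertex hs i j) w) ∧
      ((∃ w, (crossesWrenchesGraph h n₀ i₀ j₀).Adj (topVertex hs i j) w) →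
        ∃! w, M.Adj (topVertex hs i j) w) := by
    unfold SimpleGraph.Subgraph.IsMatching
    rw [hv]
    constructor
    · exact fun H i j => ⟨fun hw => H hw, fun hw => H hw⟩
    · intro H v hw
      obtain ⟨i, j, rfl | rfl⟩ := v.eq_bottom_or_top hs
      exacts [(H i j).1 hw, (H i j).2 hw]
  rw [step₁]
  refine forall_congr' fun i => forall_congr' fun j => ?_
  have z : ∀ p : Prop, (if p then (1 : ℤ) else 0) = 0 ∨ (if p then (1 : ℤ) else 0) = 1 := by
    intro p; split_ifs <;> simp
  have z₁ : ∀ p : Prop, (if p then (1 : ℤ) else 0) = 1 ↔ p := by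
    intro p; split_ifs <;> simp [*]
  have z₀ : ∀ p : Prop, (if p then (1 : ℤ) else 0) = 0 ↔ ¬ p := by
    intro p; split_ifs <;> simp [*]
  have hH : ∀ i j, HorizAdj hs M i j →
      HorizAdj hs (crossesWrenchesGraph h n₀ i₀ j₀) i j := fun i j H => hM.2 H
  have hV : ∀ i j, VertAdj hs M i j →
      VertAdj hs (crossesWrenchesGraph h n₀ i₀ j₀) i j := fun i j H => hM.2 H
  have hW : ∀ i j, WrenchAdj hs M i j →
      WrenchAdj hs (crossesWrenchesGraph h n₀ i₀ j₀) i j := fun i j H => hM.2 H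
  simp only [horizAdj_iff] at hH
  simp only [vertAdj_iff] at hV
  simp only [wrenchAdj_iff] at hW
  rw [exists_adj_bottom_iff, exists_adj_top_iff, existsUnique_adj_bottom_iff,
    existsUnique_adj_top_iff]
  simp only [horizAdj_iff, vertAdj_iff, wrenchAdj_iff]
  have s₁ := hs i j
  have s₂ := (hs i (j + 1)).1
  have s₃ := (hs (i + 1) j).2
  have t₁ := isStepSurface_cone n₀ i₀ j₀ i j
  have t₂ : coneHeight n₀ i₀ j₀ (i + 1) (j + 1) = coneHeight n₀ i₀ j₀ (i + 1) j +
      coneHeight n₀ i₀ j₀ i (j + 1) - coneHeight n₀ i₀ j₀ i j := by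
    unfold coneHeight; ring
  have e₁ := he i j
  have e₂ := isEvenSurface_cone hn i j
  rw [square_matching_iff s₁.1 s₁.2 s₂ s₃ t₁.1 t₁.2 t₂ (by omega) (z _) (z _) (z _) (z _) (z _)
    (fun H => hH _ _ ((z₁ _).1 H)) (fun H => hH _ _ ((z₁ _).1 H)) (fun H => hV _ _ ((z₁ _).1 H))
    (fun H => hV _ _ ((z₁ _).1 H)) (fun H => hW _ _ ((z₁ _).1 H))]
  simp only [z₁, z₀]
  rfl

/-- The squares containing the two ends distinguish horizontal, vertical and inner edges, so
prescribing one kind in `subgraphOf` does not create edges of another. -/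
theorem isPair_squares {v w v' w' : GraphVertex h} {a b c d p q r s : ℤ}
    (hv : InSquare hs v a b) (hw : InSquare hs w c d) (hv' : InSquare hs v' p q)
    (hw' : InSquare hs w' r s) (H : IsPair v w v' w') :
    ((a = p ∧ b = q) ∧ c = r ∧ d = s) ∨ ((a = r ∧ b = s) ∧ c = p ∧ d = q) := by
  rcases H with ⟨h₁, h₂⟩ | ⟨h₁, h₂⟩
  · exact .inl ⟨InSquare.unique_of_eq hs h₁ hv hv', InSquare.unique_of_eq hs h₂ hw hw'⟩
  · exact .inr ⟨InSquare.unique_of_eq hs h₁ hv hw', InSquare.unique_of_eq hs h₂ hw hv'⟩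

/-- The subgraph of `G` with given dual segments and edges inside squares. -/
def subgraphOf (G : (infiniteGraph h).Subgraph) (A B W : ℤ → ℤ → Prop)
    (hA : ∀ i j, A i j → HorizAdj hs G i j) (hB : ∀ i j, B i j → VertAdj hs G i j)
    (hW : ∀ i j, W i j → WrenchAdj hs G i j) : (infiniteGraph h).Subgraph where
  verts := G.verts
  Adj v w := (∃ i j, A i j ∧ IsPair v w (bottomVertex hs i j) (topVertex hs i (j - 1))) ∨
    (∃ i j, B i j ∧ IsPair v w (leftVertex hs i j) (rightVertex hs (i - 1) j)) ∨
    (∃ i j, W i j ∧ IsPair v w (bottomVertex hs i j) (topVertex hs i j))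
  adj_sub H := G.adj_sub ((subgraph_adj_iff hs G).2 (H.imp
    (fun ⟨i, j, h₁, h₂⟩ => ⟨i, j, hA i j h₁, h₂⟩)
    (Or.imp (fun ⟨i, j, h₁, h₂⟩ => ⟨i, j, hB i j h₁, h₂⟩)
      (fun ⟨i, j, h₁, h₂⟩ => ⟨i, j, hW i j h₁, h₂⟩))))
  edge_vert H := G.edge_vert ((subgraph_adj_iff hs G).2 (H.imp
    (fun ⟨i, j, h₁, h₂⟩ => ⟨i, j, hA i j h₁, h₂⟩)
    (Or.imp (fun ⟨i, j, h₁, h₂⟩ => ⟨i, j, hB i j h₁, h₂⟩)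
      (fun ⟨i, j, h₁, h₂⟩ => ⟨i, j, hW i j h₁, h₂⟩))))
  symm := ⟨fun _ _ H => H.imp (fun ⟨i, j, h₁, h₂⟩ => ⟨i, j, h₁, h₂.symm.imp And.symm And.symm⟩)
    (Or.imp (fun ⟨i, j, h₁, h₂⟩ => ⟨i, j, h₁, h₂.symm.imp And.symm And.symm⟩)
      (fun ⟨i, j, h₁, h₂⟩ => ⟨i, j, h₁, h₂.symm.imp And.symm And.symm⟩))⟩

section SubgraphOf

variable {G : (infiniteGraph h).Subgraph} {A B W : ℤ → ℤ → Prop}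
    (hA : ∀ i j, A i j → HorizAdj hs G i j) (hB : ∀ i j, B i j → VertAdj hs G i j)
    (hW : ∀ i j, W i j → WrenchAdj hs G i j)

theorem subgraphOf_le : subgraphOf hs G A B W hA hB hW ≤ G :=
  ⟨le_rfl, fun _ _ H => (subgraph_adj_iff hs G).2 (H.imp
    (fun ⟨i, j, h₁, h₂⟩ => ⟨i, j, hA i j h₁, h₂⟩)
    (Or.imp (fun ⟨i, j, h₁, h₂⟩ => ⟨i, j, hB i j h₁, h₂⟩)
      (fun ⟨i, j, h₁, h₂⟩ => ⟨i, j, hW i j h₁, h₂⟩)))⟩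

theorem horizAdj_subgraphOf (i j : ℤ) :
    HorizAdj hs (subgraphOf hs G A B W hA hB hW) i j ↔ A i j := by
  constructor
  · rintro (⟨p, q, h₁, h₂⟩ | ⟨p, q, h₁, h₂⟩ | ⟨p, q, h₁, h₂⟩)
    · have := isPair_squares hs (inSquare_bottom hs) (inSquare_top hs) (inSquare_bottom hs)
        (inSquare_top hs) h₂
      obtain ⟨rfl, rfl⟩ : i = p ∧ j = q := by omega
      exact h₁
    · have := isPair_squares hs (inSquare_bottom hs) (inSquare_top hs) (inSquare_left hs)
        (inSquare_right hs) h₂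
      omega
    · have := isPair_squares hs (inSquare_bottom hs) (inSquare_top hs) (inSquare_bottom hs)
        (inSquare_top hs) h₂
      omega
  · exact fun H => .inl ⟨i, j, H, .inl ⟨rfl, rfl⟩⟩

theorem vertAdj_subgraphOf (i j : ℤ) :
    VertAdj hs (subgraphOf hs G A B W hA hB hW) i j ↔ B i j := by
  constructor
  · rintro (⟨p, q, h₁, h₂⟩ | ⟨p, q, h₁, h₂⟩ | ⟨p, q, h₁, h₂⟩)
    · have := isPair_squares hs (inSquare_left hs) (inSquare_right hs) (inSquare_bottom hs)
        (inSquare_top hs) h₂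
      omega
    · have := isPair_squares hs (inSquare_left hs) (inSquare_right hs) (inSquare_left hs)
        (inSquare_right hs) h₂
      obtain ⟨rfl, rfl⟩ : i = p ∧ j = q := by omega
      exact h₁
    · have := isPair_squares hs (inSquare_left hs) (inSquare_right hs) (inSquare_bottom hs)
        (inSquare_top hs) h₂
      omega
  · exact fun H => .inr (.inl ⟨i, j, H, .inl ⟨rfl, rfl⟩⟩)

theorem wrenchAdj_subgraphOf (i j : ℤ) :
    WrenchAdj hs (subgraphOf hs G A B W hA hB hW) i j ↔ W i j := by
  constructor
  · rintro (⟨p, q, h₁, h₂⟩ | ⟨p, q, h₁, h₂⟩ | ⟨p, q, h₁, h₂⟩)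
    · have := isPair_squares hs (inSquare_bottom hs) (inSquare_top hs) (inSquare_bottom hs)
        (inSquare_top hs) h₂
      omega
    · have := isPair_squares hs (inSquare_bottom hs) (inSquare_top hs) (inSquare_left hs)
        (inSquare_right hs) h₂
      omega
    · have := isPair_squares hs (inSquare_bottom hs) (inSquare_top hs) (inSquare_bottom hs)
        (inSquare_top hs) h₂
      obtain ⟨rfl, rfl⟩ : i = p ∧ j = q := by omega
      exact h₁
  · exact fun H => .inr (.inr ⟨i, j, H, .inl ⟨rfl, rfl⟩⟩)

theorem exists_subgraph (G : (infiniteGraph h).Subgraph) (A B W : ℤ → ℤ → Prop)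
    (hA : ∀ i j, A i j → HorizAdj hs G i j) (hB : ∀ i j, B i j → VertAdj hs G i j)
    (hW : ∀ i j, W i j → WrenchAdj hs G i j) :
    ∃ M ≤ G, M.verts = G.verts ∧ (∀ i j, HorizAdj hs M i j ↔ A i j) ∧
      (∀ i j, VertAdj hs M i j ↔ B i j) ∧ ∀ i j, WrenchAdj hs M i j ↔ W i j :=
  ⟨subgraphOf hs G A B W hA hB hW, subgraphOf_le hs hA hB hW, rfl,
    horizAdj_subgraphOf hs hA hB hW, vertAdj_subgraphOf hs hA hB hW,
    wrenchAdj_subgraphOf hs hA hB hW⟩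

end SubgraphOf

open Classical in
/-- Matchings correspond to valid sets of segments for the completed surface. -/
theorem matchingCount_eq_card {h : ℤ → ℤ → ℤ} (hs : IsStepSurface h) {n₀ i₀ j₀ : ℤ} (he : IsEvenSurface h) (hn : (n₀ - i₀ - j₀) % 2 = 0)
    {E : Finset (Bool × ℤ × ℤ)}
    (hE : ∀ i j, h i j < coneHeight n₀ i₀ j₀ i j →
      {(false, i, j), (true, i, j), (false, i - 1, j), (true, i, j - 1)} ⊆ E) :
    matchingCount h n₀ i₀ j₀ = (E.powerset.filter fun S =>
      ∀ i j, SquareValid (completion h n₀ i₀ j₀) (segInd S false) (segInd S true) i j).card := by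
  have hEH : ∀ i j, HorizAdj hs (crossesWrenchesGraph h n₀ i₀ j₀) i j → (false, i, j) ∈ E := by
    intro i j H
    rw [horizAdj_iff] at H
    rcases H with H | H
    · exact hE _ _ H (by simp)
    · exact hE _ _ H (by simp)
  have hEV : ∀ i j, VertAdj hs (crossesWrenchesGraph h n₀ i₀ j₀) i j → (true, i, j) ∈ E := by
    intro i j H
    rw [vertAdj_iff] at H
    rcases H with H | H
    · exact hE _ _ H (by simp)
    · exact hE _ _ H (by simp)
  let seg (M : (infiniteGraph h).Subgraph) : Finset (Bool × ℤ × ℤ) :=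
    E.filter fun s => if s.1 then VertAdj hs M s.2.1 s.2.2 else HorizAdj hs M s.2.1 s.2.2
  have segH : ∀ M ≤ crossesWrenchesGraph h n₀ i₀ j₀, ∀ i j,
      (false, i, j) ∈ seg M ↔ HorizAdj hs M i j := by
    intro M hM i j
    simp only [seg, Finset.mem_filter, Bool.false_eq_true, if_false, and_iff_right_iff_imp]
    exact fun H => hEH i j (hM.2 H)
  have segV : ∀ M ≤ crossesWrenchesGraph h n₀ i₀ j₀, ∀ i j,
      (true, i, j) ∈ seg M ↔ VertAdj hs M i j := by
    intro M hM i j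
    simp only [seg, Finset.mem_filter, if_true, and_iff_right_iff_imp]
    exact fun H => hEV i j (hM.2 H)
  have indH : ∀ M ≤ crossesWrenchesGraph h n₀ i₀ j₀, segInd (seg M) false =
      fun i j => if HorizAdj hs M i j then 1 else 0 := by
    intro M hM
    funext i j
    simp only [segInd, segH M hM]
  have indV : ∀ M ≤ crossesWrenchesGraph h n₀ i₀ j₀, segInd (seg M) true =
      fun i j => if VertAdj hs M i j then 1 else 0 := by
    intro M hM
    funext i j
    simp only [segInd, segV M hM]
  unfold matchingCount
  rw [← Set.ncard_coe_finset]
  refine Set.ncard_congr (fun M _ => seg M) ?_ ?_ ?_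
  · rintro M ⟨hM, hmat, hv⟩
    rw [Finset.mem_coe, Finset.mem_filter, indH M hM, indV M hM]
    exact ⟨Finset.mem_powerset.2 (Finset.filter_subset _ _),
      fun i j => ((isMatching_iff hs he hn hM hv).1 hmat i j).1⟩
  · rintro M N ⟨hM, hMm, hMv⟩ ⟨hN, hNm, hNv⟩ hMN
    have hH : ∀ i j, HorizAdj hs M i j ↔ HorizAdj hs N i j := by
      intro i j
      rw [← segH M hM, ← segH N hN, hMN]
    have hV : ∀ i j, VertAdj hs M i j ↔ VertAdj hs N i j := by
      intro i j
      rw [← segV M hM, ← segV N hN, hMN]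
    refine subgraph_ext hs (hMv.trans hNv.symm) hH hV fun i j => ?_
    rw [((isMatching_iff hs he hn hM hMv).1 hMm i j).2,
      ((isMatching_iff hs he hn hN hNv).1 hNm i j).2, hH, hH, hV, hV]
  · intro S hS
    rw [Finset.mem_coe, Finset.mem_filter, Finset.mem_powerset] at hS
    obtain ⟨hSE, hS⟩ := hS
    -- Surjectivity rests on this: a valid set could a priori use segments of `E` whose dual edges
    -- are not in the finite graph.
    have hcl : ∀ s ∈ S, h s.2.1 s.2.2 < coneHeight n₀ i₀ j₀ s.2.1 s.2.2 ∨
        h (segEnd s).1 (segEnd s).2 < coneHeight n₀ i₀ j₀ (segEnd s).1 (segEnd s).2 := by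
      intro s hsS
      have := exists_closed_of_mem (isStepSurface_completion hs he hn)
        (completion_le h n₀ i₀ j₀) hS hsS
      simpa only [completion, min_lt_iff, lt_irrefl, or_false] using this
    let A (i j : ℤ) : Prop := (false, i, j) ∈ S
    let B (i j : ℤ) : Prop := (true, i, j) ∈ S
    have hA : ∀ i j, A i j →
        HorizAdj hs (crossesWrenchesGraph h n₀ i₀ j₀) i j :=
      fun i j H => (horizAdj_iff hs n₀ i₀ j₀ i j).2 (by simpa [segEnd] using hcl _ H)
    have hB : ∀ i j, B i j →
        VertAdj hs (crossesWrenchesGraph h n₀ i₀ j₀) i j :=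
      fun i j H => (vertAdj_iff hs n₀ i₀ j₀ i j).2 (by simpa [segEnd] using hcl _ H)
    let W (i j : ℤ) : Prop := WrenchAdj hs (crossesWrenchesGraph h n₀ i₀ j₀) i j ∧
      (false, i, j) ∉ S ∧ (false, i, j + 1) ∉ S ∧ (true, i, j) ∉ S ∧ (true, i + 1, j) ∉ S
    have hW : ∀ i j, W i j → WrenchAdj hs (crossesWrenchesGraph h n₀ i₀ j₀) i j :=
      fun i j H => H.1
    obtain ⟨M, hM, hv, mH, mV, mW⟩ := exists_subgraph hs _ A B W hA hB hW
    have hseg : seg M = S := by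
      ext ⟨k, i, j⟩
      cases k
      · rw [segH M hM, mH]
      · rw [segV M hM, mV]
    refine ⟨M, ⟨hM, (isMatching_iff hs he hn hM hv).2 fun i j => ⟨?_, ?_⟩, hv⟩, hseg⟩
    · rw [← indH M hM, ← indV M hM, hseg]
      exact hS i j
    · rw [mW, mH, mH, mV, mV]

end Counting

/-! ### Matching numbers as solutions of the octahedron recurrence. -/

theorem IsHeightFunction.isStepSurface {h : ℤ → ℤ → ℤ} (hh : IsHeightFunction h) :
    IsStepSurface h := by
  intro i j
  have h₁ := hh.step (i + 1, j) (i, j) (by simp [LatticeAdjacent])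
  have h₂ := hh.step (i, j + 1) (i, j) (by simp [LatticeAdjacent])
  dsimp only at h₁ h₂
  have := abs_choice (h (i + 1) j - h i j)
  have := abs_choice (h i (j + 1) - h i j)
  omega

theorem IsHeightFunction.isEvenSurface {h : ℤ → ℤ → ℤ} (hh : IsHeightFunction h) :
    IsEvenSurface h := by
  intro i j
  have : h i j % 2 = (i + j) % 2 := hh.mem_lattice i j
  omega

theorem IsHeightFunction.finite_closed {h : ℤ → ℤ → ℤ} (hh : IsHeightFunction h) (n₀ i₀ j₀ : ℤ) :
    {f : ℤ × ℤ | h f.1 f.2 < coneHeight n₀ i₀ j₀ f.1 f.2}.Finite := by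
  -- By the triangle inequality the cone height at `(i, j)` is at most this constant minus `|i| +
  -- |j|`.
  obtain ⟨R, hR⟩ := hh.tendsto (n₀ + |i₀| + |j₀|)
  refine (Set.finite_Icc (-R, -R) (R, R)).subset ?_
  rintro ⟨i, j⟩ hf
  have hf' : h i j < n₀ - |i - i₀| - |j - j₀| := hf
  have h₁ := abs_sub_abs_le_abs_sub i i₀
  have h₂ := abs_sub_abs_le_abs_sub j j₀
  have h₃ : |i| + |j| < R := by
    by_contra hc
    have := hR i j (not_lt.1 hc)
    omega
  have h₄ := abs_nonneg i
  have h₅ := abs_nonneg j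
  have h₆ := abs_le.1 (show |i| ≤ R by omega)
  have h₇ := abs_le.1 (show |j| ≤ R by omega)
  exact ⟨⟨h₆.1, h₇.1⟩, ⟨h₆.2, h₇.2⟩⟩

/-- The numbers of matchings agree with any nowhere vanishing solution of the octahedron recurrence
which is `1` on the initial surface. -/
theorem matchingCount_eq {h : ℤ → ℤ → ℤ} (hh : IsHeightFunction h) {f : ℤ → ℤ → ℤ → ℚ}
    (hf0 : ∀ n i j, f n i j ≠ 0)
    (hf : ∀ n i j, (n - i - j) % 2 = 0 → f n i j * f (n - 2) i j =
      f (n - 1) i (j + 1) * f (n - 1) i (j - 1) + f (n - 1) (i + 1) j * f (n - 1) (i - 1) j)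
    (hf1 : ∀ i j, f (h i j) i j = 1) {n i j : ℤ}
    (hmem : (n, i, j) ∈ initialSet h ∪ upperSet h) : (matchingCount h n i j : ℚ) = f n i j := by
  have hs := hh.isStepSurface
  have he := hh.isEvenSurface
  have hL : n % 2 = (i + j) % 2 := by
    rcases hmem with hm | hm
    exacts [hm.1, hm.1]
  have hle : h i j ≤ n := by
    rcases hmem with hm | hm
    exacts [hm.2.ge, hm.2.le]
  have hn : (n - i - j) % 2 = 0 := by omega
  classical
  set B := (hh.finite_closed n i j).toFinset with hBdef
  have hB : ∀ p q, h p q < coneHeight n i j p q → (p, q) ∈ B := by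
    intro p q hpq
    rw [hBdef, Set.Finite.mem_toFinset]
    exact hpq
  let E : Finset (Bool × ℤ × ℤ) := B.biUnion fun b =>
    {(false, b.1, b.2), (true, b.1, b.2), (false, b.1 - 1, b.2), (true, b.1, b.2 - 1)}
  -- The apex is inserted by hand because `B` is empty when the point lies on the initial surface.
  let F : Finset (ℤ × ℤ) := insert (i, j) (B.biUnion fun b =>
    {(b.1, b.2), (b.1 + 1, b.2), (b.1, b.2 + 1), (b.1 - 1, b.2), (b.1, b.2 - 1)})
  have hE : ∀ p q, (p, q) ∈ B →
      {(false, p, q), (true, p, q), (false, p - 1, q), (true, p, q - 1)} ⊆ E := fun p q hpq =>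
    Finset.subset_biUnion_of_mem (fun b : ℤ × ℤ => ({(false, b.1, b.2), (true, b.1, b.2),
      (false, b.1 - 1, b.2), (true, b.1, b.2 - 1)} : Finset (Bool × ℤ × ℤ))) hpq
  have hF : ∀ p q, (p, q) ∈ B →
      {(p, q), (p + 1, q), (p, q + 1), (p - 1, q), (p, q - 1)} ⊆ F := fun p q hpq =>
    (Finset.subset_biUnion_of_mem (fun b : ℤ × ℤ => ({(b.1, b.2), (b.1 + 1, b.2), (b.1, b.2 + 1),
      (b.1 - 1, b.2), (b.1, b.2 - 1)} : Finset (ℤ × ℤ))) hpq).trans (Finset.subset_insert _ _)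
  rw [← partitionSum_completion hf0 hf hn hE hF (Finset.mem_insert_self _ _) h hs he hB hle,
    matchingCount_eq_card hs he hn (E := E) (fun p q hpq => hE p q (hB p q hpq))]
  unfold partitionSum segWeight
  rw [Finset.card_filter]
  push_cast
  refine Finset.sum_congr rfl fun S _ => ?_
  simp [hf1]

theorem mem_initial_union_upper_iff {h : ℤ → ℤ → ℤ} {n i j : ℤ} :
    (n, i, j) ∈ initialSet h ∪ upperSet h ↔ (n - i - j) % 2 = 0 ∧ h i j ≤ n := by
  have hL : (n, i, j) ∈ octLattice ↔ (n - i - j) % 2 = 0 := by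
    change n % 2 = (i + j) % 2 ↔ _
    omega
  change ((n, i, j) ∈ octLattice ∧ n = h i j) ∨ ((n, i, j) ∈ octLattice ∧ h i j < n) ↔ _
  rw [hL]
  omega

theorem satisfiesOctahedronRecurrence_matchingCount {h : ℤ → ℤ → ℤ} (hh : IsHeightFunction h)
    {f : ℤ → ℤ → ℤ → ℚ} (hf0 : ∀ n i j, f n i j ≠ 0)
    (hf : ∀ n i j, (n - i - j) % 2 = 0 → f n i j * f (n - 2) i j =
      f (n - 1) i (j + 1) * f (n - 1) i (j - 1) + f (n - 1) (i + 1) j * f (n - 1) (i - 1) j)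
    (hf1 : ∀ i j, f (h i j) i j = 1) : SatisfiesOctahedronRecurrence h (matchingCount h) := by
  have hs := hh.isStepSurface
  have he := hh.isEvenSurface
  constructor
  · intro n i j hm
    have := matchingCount_eq hh hf0 hf hf1 (Or.inl hm)
    obtain ⟨-, rfl⟩ : _ ∧ n = h i j := hm
    rw [hf1] at this
    exact_mod_cast this
  · intro n i j hm
    have hm' := mem_initial_union_upper_iff.1 (Or.inr hm)
    have hlt : h i j < n := hm.2
    have e := he i j
    have s := hs i j
    have sW := (hs (i - 1) j).1
    have sS := (hs i (j - 1)).2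
    rw [sub_add_cancel] at sW sS
    have key : ∀ {n i j : ℤ}, (n - i - j) % 2 = 0 ∧ h i j ≤ n →
        (matchingCount h n i j : ℚ) = f n i j := fun H =>
      matchingCount_eq hh hf0 hf hf1 (mem_initial_union_upper_iff.2 H)
    -- Parity gives `h i j ≤ n - 2`, so neighbouring heights are at most `n - 1`, and all six points
    -- of the recurrence lie on or above the surface.
    have := hf n i j hm'.1
    rw [← key hm', ← key (i := i) (j := j) (n := n - 2) (by omega),
      ← key (i := i) (j := j + 1) (n := n - 1) (by omega),
      ← key (i := i) (j := j - 1) (n := n - 1) (by omega),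
      ← key (i := i + 1) (j := j) (n := n - 1) (by omega),
      ← key (i := i - 1) (j := j) (n := n - 1) (by omega)] at this
    exact_mod_cast this

theorem isHeightFunction_of_values {h : ℤ → ℤ → ℤ} (h₀ : ∀ i j, (i + j) % 2 = 0 → h i j = 0)
    (h₁ : ∀ i j, (i + j) % 2 = 1 → h i j = 1 ∨ h i j = -1) : IsHeightFunction h := by
  have h₂ : ∀ i j, (((i + j) % 2 = 0 ∧ h i j = 0) ∨ ((i + j) % 2 = 1 ∧ h i j = 1)) ∨
      ((i + j) % 2 = 1 ∧ h i j = -1) := by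
    intro i j
    have := h₀ i j
    have := h₁ i j
    omega
  refine ⟨?_, ?_, ?_⟩
  · rintro ⟨i, j⟩ ⟨p, q⟩ hadj
    unfold LatticeAdjacent at hadj
    dsimp only at hadj ⊢
    have a₁ := abs_choice (i - p)
    have a₂ := abs_choice (j - q)
    have b₁ := h₂ i j
    have b₂ := h₂ p q
    rw [abs_eq one_pos.le]
    omega
  · intro i j
    change h i j % 2 = (i + j) % 2
    have := h₂ i j
    omega
  · intro B
    refine ⟨B + 1, fun i j hij => ?_⟩
    have := h₂ i j
    omega

/-! ### Explicit solutions for the three families. -/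

/-- The coefficient `1` or `2`, according to the parity of `t`. -/
def parityCoeff (t : ℤ) : ℚ := if t % 2 = 0 then 1 else 2

theorem parityCoeff_ne_zero (t : ℤ) : parityCoeff t ≠ 0 := by
  unfold parityCoeff; split_ifs <;> norm_num

theorem parityCoeff_of_even {t : ℤ} (ht : t % 2 = 0) : parityCoeff t = 1 := if_pos ht

theorem parityCoeff_of_odd {t : ℤ} (ht : t % 2 = 1) : parityCoeff t = 2 :=
  if_neg (by omega)

theorem parityCoeff_congr {s t : ℤ} (h : (s - t) % 2 = 0) : parityCoeff s = parityCoeff t := by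
  unfold parityCoeff
  rw [show s % 2 = t % 2 by omega]

theorem parityCoeff_mul_of_odd {s t : ℤ} (h : (s - t) % 2 = 1) :
    parityCoeff s * parityCoeff t = 2 := by
  rcases Int.emod_two_eq_zero_or_one s with hs | hs
  · rw [parityCoeff_of_even hs, parityCoeff_of_odd (by omega), one_mul]
  · rw [parityCoeff_of_odd hs, parityCoeff_of_even (by omega), mul_one]

theorem parityCoeff_sq_add_sq {s t : ℤ} (h : (s - t) % 2 = 1) :
    parityCoeff s * parityCoeff s + parityCoeff t * parityCoeff t = 5 := by
  rcases Int.emod_two_eq_zero_or_one s with hs | hs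
  · rw [parityCoeff_of_even hs, parityCoeff_of_odd (by omega)]; norm_num
  · rw [parityCoeff_of_odd hs, parityCoeff_of_even (by omega)]; norm_num

/-- The coefficients 1 and 2 are the roots of t² - 3t + 2; this produces the factor 3 for Blum's
graphs. -/
theorem two_add_parityCoeff_sq (t : ℤ) :
    2 + parityCoeff t * parityCoeff t = 3 * parityCoeff t := by
  unfold parityCoeff; split_ifs <;> norm_num

theorem exists_eq_two_mul (n : ℤ) : ∃ m, n = 2 * m ∨ n = 2 * m + 1 := ⟨n / 2, by omega⟩

theorem exists_eq_three_mul (n : ℤ) : ∃ m, n = 3 * m ∨ n = 3 * m + 1 ∨ n = 3 * m + 2 :=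
  ⟨n / 3, by omega⟩

/-- The solution of the octahedron recurrence for fortresses. -/
def fortressSolution (n i _j : ℤ) : ℚ :=
  if n % 2 = 0 then 5 ^ ((n / 2) ^ 2) else parityCoeff (i - n / 2) * 5 ^ ((n / 2) ^ 2 + n / 2)

theorem fortressSolution_even (m i j : ℤ) : fortressSolution (2 * m) i j = 5 ^ (m ^ 2) := by
  rw [fortressSolution, if_pos (by omega), show 2 * m / 2 = m by omega]

theorem fortressSolution_odd (m i j : ℤ) :
    fortressSolution (2 * m + 1) i j = parityCoeff (i - m) * 5 ^ (m ^ 2 + m) := by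
  rw [fortressSolution, if_neg (by omega), show (2 * m + 1) / 2 = m by omega]

theorem fortressSolution_ne_zero (n i j : ℤ) : fortressSolution n i j ≠ 0 := by
  unfold fortressSolution
  split_ifs
  · positivity
  · exact mul_ne_zero (parityCoeff_ne_zero _) (by positivity)

/-- At even levels the two products on the right carry the squares of the two different
coefficients, with sum 5. At odd levels the coefficients on the left multiply to 2, matching two
equal terms. -/
theorem fortressSolution_recurrence (n i j : ℤ) :
    fortressSolution n i j * fortressSolution (n - 2) i j =
      fortressSolution (n - 1) i (j + 1) * fortressSolution (n - 1) i (j - 1) +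
        fortressSolution (n - 1) (i + 1) j * fortressSolution (n - 1) (i - 1) j := by
  have h5 : (5 : ℚ) ≠ 0 := by norm_num
  obtain ⟨m, rfl | rfl⟩ := exists_eq_two_mul n
  · rw [show 2 * m - 2 = 2 * (m - 1) by ring, show 2 * m - 1 = 2 * (m - 1) + 1 by ring]
    simp only [fortressSolution_even, fortressSolution_odd]
    have e : (5 : ℚ) ^ (m ^ 2) * 5 ^ ((m - 1) ^ 2) =
        5 * (5 ^ ((m - 1) ^ 2 + (m - 1)) * 5 ^ ((m - 1) ^ 2 + (m - 1))) := by
      rw [← zpow_add₀ h5, ← zpow_add₀ h5, ← zpow_one_add₀ h5]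
      congr 1; ring
    rw [e, ← parityCoeff_sq_add_sq (s := i - (m - 1)) (t := i + 1 - (m - 1)) (by omega),
      parityCoeff_congr (s := i - 1 - (m - 1)) (t := i + 1 - (m - 1)) (by omega)]
    ring
  · rw [show 2 * m + 1 - 2 = 2 * (m - 1) + 1 by ring, show 2 * m + 1 - 1 = 2 * m by ring]
    simp only [fortressSolution_even, fortressSolution_odd]
    have e : (5 : ℚ) ^ (m ^ 2 + m) * 5 ^ ((m - 1) ^ 2 + (m - 1)) = 5 ^ (m ^ 2) * 5 ^ (m ^ 2) := by
      rw [← zpow_add₀ h5, ← zpow_add₀ h5]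
      congr 1; ring
    have c := parityCoeff_mul_of_odd (s := i - m) (t := i - (m - 1)) (by omega)
    linear_combination (5 ^ (m ^ 2 + m) * 5 ^ ((m - 1) ^ 2 + (m - 1))) * c + 2 * e

theorem fortressSolution_fortressHeight (i j : ℤ) :
    fortressSolution (fortressHeight i j) i j = 1 := by
  unfold fortressHeight
  split_ifs with h₁ h₂
  · simpa using fortressSolution_even 0 i j
  · have := fortressSolution_odd 0 i j
    rw [parityCoeff_of_even (by omega)] at this
    simpa using this
  · have := fortressSolution_odd (-1) i j
    rw [parityCoeff_of_even (by omega)] at this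
    simpa using this

theorem isHeightFunction_fortressHeight : IsHeightFunction fortressHeight := by
  refine isHeightFunction_of_values (fun i j h => if_pos h) fun i j h => ?_
  unfold fortressHeight
  split_ifs <;> omega

/-- The solution of the octahedron recurrence for Douglass' graphs. -/
def douglassSolution (n i j : ℤ) : ℚ :=
  if n % 2 = 0 then 2 ^ (2 * (n / 2) ^ 2)
  else parityCoeff ((i + j - 1) / 2 - n / 2) * 2 ^ (2 * (n / 2) ^ 2 + 2 * (n / 2))

theorem douglassSolution_even (m i j : ℤ) : douglassSolution (2 * m) i j = 2 ^ (2 * m ^ 2) := by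
  rw [douglassSolution, if_pos (by omega), show 2 * m / 2 = m by omega]

theorem douglassSolution_odd (m i j : ℤ) : douglassSolution (2 * m + 1) i j =
    parityCoeff ((i + j - 1) / 2 - m) * 2 ^ (2 * m ^ 2 + 2 * m) := by
  rw [douglassSolution, if_neg (by omega), show (2 * m + 1) / 2 = m by omega]

theorem douglassSolution_ne_zero (n i j : ℤ) : douglassSolution n i j ≠ 0 := by
  unfold douglassSolution
  split_ifs
  · positivity
  · exact mul_ne_zero (parityCoeff_ne_zero _) (by positivity)

/-- At even levels each product on the right pairs the coefficients 1 and 2, so the sum contributes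
2 + 2 = 4. Odd levels work as for fortresses. -/
theorem douglassSolution_recurrence (n i j : ℤ) :
    douglassSolution n i j * douglassSolution (n - 2) i j =
      douglassSolution (n - 1) i (j + 1) * douglassSolution (n - 1) i (j - 1) +
        douglassSolution (n - 1) (i + 1) j * douglassSolution (n - 1) (i - 1) j := by
  have h2 : (2 : ℚ) ≠ 0 := by norm_num
  obtain ⟨m, rfl | rfl⟩ := exists_eq_two_mul n
  · rw [show 2 * m - 2 = 2 * (m - 1) by ring, show 2 * m - 1 = 2 * (m - 1) + 1 by ring]
    simp only [douglassSolution_even, douglassSolution_odd]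
    have e : (2 : ℚ) ^ (2 * m ^ 2) * 2 ^ (2 * (m - 1) ^ 2) =
        2 * 2 * (2 ^ (2 * (m - 1) ^ 2 + 2 * (m - 1)) * 2 ^ (2 * (m - 1) ^ 2 + 2 * (m - 1))) := by
      rw [← zpow_add₀ h2, ← zpow_add₀ h2, mul_assoc, ← zpow_one_add₀ h2, ← zpow_one_add₀ h2]
      congr 1; ring
    have c₁ := parityCoeff_mul_of_odd (s := (i + (j + 1) - 1) / 2 - (m - 1))
      (t := (i + (j - 1) - 1) / 2 - (m - 1)) (by omega)
    have c₂ := parityCoeff_mul_of_odd (s := (i + 1 + j - 1) / 2 - (m - 1))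
      (t := (i - 1 + j - 1) / 2 - (m - 1)) (by omega)
    linear_combination e - (2 ^ (2 * (m - 1) ^ 2 + 2 * (m - 1)) *
      2 ^ (2 * (m - 1) ^ 2 + 2 * (m - 1))) * (c₁ + c₂)
  · rw [show 2 * m + 1 - 2 = 2 * (m - 1) + 1 by ring, show 2 * m + 1 - 1 = 2 * m by ring]
    simp only [douglassSolution_even, douglassSolution_odd]
    have e : (2 : ℚ) ^ (2 * m ^ 2 + 2 * m) * 2 ^ (2 * (m - 1) ^ 2 + 2 * (m - 1)) =
        2 ^ (2 * m ^ 2) * 2 ^ (2 * m ^ 2) := by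
      rw [← zpow_add₀ h2, ← zpow_add₀ h2]
      congr 1; ring
    have c := parityCoeff_mul_of_odd (s := (i + j - 1) / 2 - m) (t := (i + j - 1) / 2 - (m - 1))
      (by omega)
    linear_combination
      (2 ^ (2 * m ^ 2 + 2 * m) * 2 ^ (2 * (m - 1) ^ 2 + 2 * (m - 1))) * c + 2 * e

theorem douglassSolution_douglassHeight (i j : ℤ) :
    douglassSolution (douglassHeight i j) i j = 1 := by
  unfold douglassHeight
  split_ifs with h₁ h₂
  · simpa using douglassSolution_even 0 i j
  · have := douglassSolution_odd 0 i j
    rw [parityCoeff_of_even (by omega)] at this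
    simpa using this
  · have := douglassSolution_odd (-1) i j
    rw [parityCoeff_of_even (by omega)] at this
    simpa using this

theorem isHeightFunction_douglassHeight : IsHeightFunction douglassHeight := by
  refine isHeightFunction_of_values (fun i j h => if_pos h) fun i j h => ?_
  unfold douglassHeight
  split_ifs <;> omega

/-- The solution of the octahedron recurrence for Blum's graphs. -/
def blumSolution (n _i j : ℤ) : ℚ :=
  if n % 3 = 0 then 3 ^ (3 * (n / 3) ^ 2)
  else parityCoeff (n / 3 + j / 2) * (if n % 3 = 1 then 3 ^ (3 * (n / 3) ^ 2 + 2 * (n / 3))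
    else 3 ^ (3 * (n / 3) ^ 2 + 4 * (n / 3) + 1))

theorem blumSolution_zero_mod (m i j : ℤ) : blumSolution (3 * m) i j = 3 ^ (3 * m ^ 2) := by
  rw [blumSolution, if_pos (by omega), show 3 * m / 3 = m by omega]

theorem blumSolution_one_mod (m i j : ℤ) :
    blumSolution (3 * m + 1) i j = parityCoeff (m + j / 2) * 3 ^ (3 * m ^ 2 + 2 * m) := by
  rw [blumSolution, if_neg (by omega), if_pos (by omega), show (3 * m + 1) / 3 = m by omega]

theorem blumSolution_two_mod (m i j : ℤ) :
    blumSolution (3 * m + 2) i j = parityCoeff (m + j / 2) * 3 ^ (3 * m ^ 2 + 4 * m + 1) := by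
  rw [blumSolution, if_neg (by omega), if_neg (by omega), show (3 * m + 2) / 3 = m by omega]

theorem blumSolution_ne_zero (n i j : ℤ) : blumSolution n i j ≠ 0 := by
  unfold blumSolution
  split_ifs
  · positivity
  · exact mul_ne_zero (parityCoeff_ne_zero _) (by positivity)
  · exact mul_ne_zero (parityCoeff_ne_zero _) (by positivity)

/-- The floors of `(j + 1) / 2` and `(j - 1) / 2` are consecutive, so the vertical product has
coefficient 2, while the horizontal one has a square t². For `n` congruent to 0 or 2 mod 3 this is 2
+ t² = 3t; for 1 mod 3 the right side is a sum of two equal powers and the left coefficients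
multiply to 2. -/
theorem blumSolution_recurrence (n i j : ℤ) :
    blumSolution n i j * blumSolution (n - 2) i j =
      blumSolution (n - 1) i (j + 1) * blumSolution (n - 1) i (j - 1) +
        blumSolution (n - 1) (i + 1) j * blumSolution (n - 1) (i - 1) j := by
  have h3 : (3 : ℚ) ≠ 0 := by norm_num
  obtain ⟨m, rfl | rfl | rfl⟩ := exists_eq_three_mul n
  · rw [show 3 * m - 2 = 3 * (m - 1) + 1 by ring, show 3 * m - 1 = 3 * (m - 1) + 2 by ring]
    simp only [blumSolution_zero_mod, blumSolution_one_mod, blumSolution_two_mod]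
    have e : (3 : ℚ) ^ (3 * m ^ 2) * 3 ^ (3 * (m - 1) ^ 2 + 2 * (m - 1)) =
        3 * (3 ^ (3 * (m - 1) ^ 2 + 4 * (m - 1) + 1) *
          3 ^ (3 * (m - 1) ^ 2 + 4 * (m - 1) + 1)) := by
      rw [← zpow_add₀ h3, ← zpow_add₀ h3, ← zpow_one_add₀ h3]
      congr 1; ring
    have c₁ := parityCoeff_mul_of_odd (s := m - 1 + (j + 1) / 2) (t := m - 1 + (j - 1) / 2)
      (by omega)
    have c₂ := two_add_parityCoeff_sq (m - 1 + j / 2)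
    linear_combination parityCoeff (m - 1 + j / 2) * e -
      (3 ^ (3 * (m - 1) ^ 2 + 4 * (m - 1) + 1) *
        3 ^ (3 * (m - 1) ^ 2 + 4 * (m - 1) + 1)) * (c₁ + c₂)
  · rw [show 3 * m + 1 - 2 = 3 * (m - 1) + 2 by ring, show 3 * m + 1 - 1 = 3 * m by ring]
    simp only [blumSolution_zero_mod, blumSolution_one_mod, blumSolution_two_mod]
    have e : (3 : ℚ) ^ (3 * m ^ 2 + 2 * m) * 3 ^ (3 * (m - 1) ^ 2 + 4 * (m - 1) + 1) =
        3 ^ (3 * m ^ 2) * 3 ^ (3 * m ^ 2) := by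
      rw [← zpow_add₀ h3, ← zpow_add₀ h3]
      congr 1; ring
    have c := parityCoeff_mul_of_odd (s := m + j / 2) (t := m - 1 + j / 2) (by omega)
    linear_combination
      (3 ^ (3 * m ^ 2 + 2 * m) * 3 ^ (3 * (m - 1) ^ 2 + 4 * (m - 1) + 1)) * c + 2 * e
  · rw [show 3 * m + 2 - 2 = 3 * m by ring, show 3 * m + 2 - 1 = 3 * m + 1 by ring]
    simp only [blumSolution_zero_mod, blumSolution_one_mod, blumSolution_two_mod]
    have e : (3 : ℚ) ^ (3 * m ^ 2 + 4 * m + 1) * 3 ^ (3 * m ^ 2) =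
        3 * (3 ^ (3 * m ^ 2 + 2 * m) * 3 ^ (3 * m ^ 2 + 2 * m)) := by
      rw [← zpow_add₀ h3, ← zpow_add₀ h3, ← zpow_one_add₀ h3]
      congr 1; ring
    have c₁ := parityCoeff_mul_of_odd (s := m + (j + 1) / 2) (t := m + (j - 1) / 2) (by omega)
    have c₂ := two_add_parityCoeff_sq (m + j / 2)
    linear_combination parityCoeff (m + j / 2) * e -
      (3 ^ (3 * m ^ 2 + 2 * m) * 3 ^ (3 * m ^ 2 + 2 * m)) * (c₁ + c₂)

theorem blumSolution_blumHeight (i j : ℤ) : blumSolution (blumHeight i j) i j = 1 := by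
  unfold blumHeight
  split_ifs with h₁ h₂
  · simpa using blumSolution_zero_mod 0 i j
  · have := blumSolution_one_mod 0 i j
    rw [parityCoeff_of_even (by omega)] at this
    simpa using this
  · have := blumSolution_two_mod (-1) i j
    rw [parityCoeff_of_even (by omega)] at this
    simpa using this

theorem isHeightFunction_blumHeight : IsHeightFunction blumHeight := by
  refine isHeightFunction_of_values (fun i j h => if_pos h) fun i j h => ?_
  unfold blumHeight
  split_ifs <;> omega

/-! ### Conclusion for fortresses, Douglass' graphs and Blum's graphs. -/

theorem mainTheorem8 :
    (IsHeightFunction fortressHeight ∧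
      SatisfiesOctahedronRecurrence fortressHeight (matchingCount fortressHeight) ∧
      ∀ n i j : ℤ,
        ((2 * n, i, j) ∈ initialSet fortressHeight ∪ upperSet fortressHeight →
          (matchingCount fortressHeight (2 * n) i j : ℚ) = (5 : ℚ) ^ (n ^ 2)) ∧
        ((2 * n + 1, i, j) ∈ initialSet fortressHeight ∪ upperSet fortressHeight →
          (i ≡ n [ZMOD 2] →
            (matchingCount fortressHeight (2 * n + 1) i j : ℚ) = (5 : ℚ) ^ (n ^ 2 + n)) ∧
          (j ≡ n [ZMOD 2] →
            (matchingCount fortressHeight (2 * n + 1) i j : ℚ) = 2 * (5 : ℚ) ^ (n ^ 2 + n)))) ∧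
    (IsHeightFunction douglassHeight ∧
      SatisfiesOctahedronRecurrence douglassHeight (matchingCount douglassHeight) ∧
      ∀ n i j : ℤ,
        ((2 * n, i, j) ∈ initialSet douglassHeight ∪ upperSet douglassHeight →
          (matchingCount douglassHeight (2 * n) i j : ℚ) = (2 : ℚ) ^ (2 * n ^ 2)) ∧
        ((2 * n + 1, i, j) ∈ initialSet douglassHeight ∪ upperSet douglassHeight →
          (i + j ≡ 2 * n + 1 [ZMOD 4] →
            (matchingCount douglassHeight (2 * n + 1) i j : ℚ) =
              (2 : ℚ) ^ (2 * n ^ 2 + 2 * n)) ∧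
          (i + j ≡ 2 * n - 1 [ZMOD 4] →
            (matchingCount douglassHeight (2 * n + 1) i j : ℚ) =
              (2 : ℚ) ^ (2 * n ^ 2 + 2 * n + 1)))) ∧
    (IsHeightFunction blumHeight ∧
      SatisfiesOctahedronRecurrence blumHeight (matchingCount blumHeight) ∧
      ∀ n i j : ℤ,
        ((3 * n, i, j) ∈ initialSet blumHeight ∪ upperSet blumHeight →
          (matchingCount blumHeight (3 * n) i j : ℚ) = (3 : ℚ) ^ (3 * n ^ 2)) ∧
        ((3 * n + 1, i, j) ∈ initialSet blumHeight ∪ upperSet blumHeight →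
          ((3 * n + 1) / 3 + j / 2 ≡ 0 [ZMOD 2] →
            (matchingCount blumHeight (3 * n + 1) i j : ℚ) = (3 : ℚ) ^ (3 * n ^ 2 + 2 * n)) ∧
          ((3 * n + 1) / 3 + j / 2 ≡ 1 [ZMOD 2] →
            (matchingCount blumHeight (3 * n + 1) i j : ℚ) =
              2 * (3 : ℚ) ^ (3 * n ^ 2 + 2 * n))) ∧
        ((3 * n - 1, i, j) ∈ initialSet blumHeight ∪ upperSet blumHeight →
          ((3 * n - 1) / 3 + j / 2 ≡ 0 [ZMOD 2] →
            (matchingCount blumHeight (3 * n - 1) i j : ℚ) = (3 : ℚ) ^ (3 * n ^ 2 - 2 * n)) ∧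
          ((3 * n - 1) / 3 + j / 2 ≡ 1 [ZMOD 2] →
            (matchingCount blumHeight (3 * n - 1) i j : ℚ) =
              2 * (3 : ℚ) ^ (3 * n ^ 2 - 2 * n)))) := by
  refine ⟨⟨isHeightFunction_fortressHeight, ?_, fun n i j => ?_⟩,
    ⟨isHeightFunction_douglassHeight, ?_, fun n i j => ?_⟩,
    isHeightFunction_blumHeight, ?_, fun n i j => ?_⟩
  · exact satisfiesOctahedronRecurrence_matchingCount isHeightFunction_fortressHeight
      fortressSolution_ne_zero (fun n i j _ => fortressSolution_recurrence n i j)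
      fortressSolution_fortressHeight
  · have key : ∀ {n}, (n, i, j) ∈ initialSet fortressHeight ∪ upperSet fortressHeight →
        (matchingCount fortressHeight n i j : ℚ) = fortressSolution n i j :=
      matchingCount_eq isHeightFunction_fortressHeight fortressSolution_ne_zero
        (fun n i j _ => fortressSolution_recurrence n i j) fortressSolution_fortressHeight
    refine ⟨fun hm => ?_, fun hm => ⟨fun hc => ?_, fun hc => ?_⟩⟩
    · rw [key hm, fortressSolution_even]
    · have hc' : i % 2 = n % 2 := hc
      rw [key hm, fortressSolution_odd, parityCoeff_of_even (by omega), one_mul]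
    · have hc' : j % 2 = n % 2 := hc
      -- On the lattice `i + j` is odd here, so `j ≡ n` forces `i - n` to be odd.
      have hL := (mem_initial_union_upper_iff.1 hm).1
      rw [key hm, fortressSolution_odd, parityCoeff_of_odd (by omega)]
  · exact satisfiesOctahedronRecurrence_matchingCount isHeightFunction_douglassHeight
      douglassSolution_ne_zero (fun n i j _ => douglassSolution_recurrence n i j)
      douglassSolution_douglassHeight
  · have key : ∀ {n}, (n, i, j) ∈ initialSet douglassHeight ∪ upperSet douglassHeight →
        (matchingCount douglassHeight n i j : ℚ) = douglassSolution n i j :=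
      matchingCount_eq isHeightFunction_douglassHeight douglassSolution_ne_zero
        (fun n i j _ => douglassSolution_recurrence n i j) douglassSolution_douglassHeight
    refine ⟨fun hm => ?_, fun hm => ⟨fun hc => ?_, fun hc => ?_⟩⟩
    · rw [key hm, douglassSolution_even]
    · have hc' : (i + j) % 4 = (2 * n + 1) % 4 := hc
      rw [key hm, douglassSolution_odd, parityCoeff_of_even (by omega), one_mul]
    · have hc' : (i + j) % 4 = (2 * n - 1) % 4 := hc
      rw [key hm, douglassSolution_odd, parityCoeff_of_odd (by omega),
        zpow_add_one₀ two_ne_zero, mul_comm]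
  · exact satisfiesOctahedronRecurrence_matchingCount isHeightFunction_blumHeight
      blumSolution_ne_zero (fun n i j _ => blumSolution_recurrence n i j) blumSolution_blumHeight
  · have key : ∀ {n}, (n, i, j) ∈ initialSet blumHeight ∪ upperSet blumHeight →
        (matchingCount blumHeight n i j : ℚ) = blumSolution n i j :=
      matchingCount_eq isHeightFunction_blumHeight blumSolution_ne_zero
        (fun n i j _ => blumSolution_recurrence n i j) blumSolution_blumHeight
    -- Level `3n - 1` is the residue 2 case with quotient `n - 1`, and 3(n-1)² + 4(n-1) + 1 = 3n² -
    -- 2n.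
    have two_mod : blumSolution (3 * n - 1) i j =
        parityCoeff (n - 1 + j / 2) * 3 ^ (3 * n ^ 2 - 2 * n) := by
      rw [show 3 * n - 1 = 3 * (n - 1) + 2 by ring, blumSolution_two_mod,
        show 3 * (n - 1) ^ 2 + 4 * (n - 1) + 1 = 3 * n ^ 2 - 2 * n by ring]
    refine ⟨fun hm => ?_, fun hm => ⟨fun hc => ?_, fun hc => ?_⟩,
      fun hm => ⟨fun hc => ?_, fun hc => ?_⟩⟩
    · rw [key hm, blumSolution_zero_mod]
    · have hc' : ((3 * n + 1) / 3 + j / 2) % 2 = 0 := hc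
      rw [key hm, blumSolution_one_mod, parityCoeff_of_even (by omega), one_mul]
    · have hc' : ((3 * n + 1) / 3 + j / 2) % 2 = 1 := hc
      rw [key hm, blumSolution_one_mod, parityCoeff_of_odd (by omega)]
    · have hc' : ((3 * n - 1) / 3 + j / 2) % 2 = 0 := hc
      rw [key hm, two_mod, parityCoeff_of_even (by omega), one_mul]
    · have hc' : ((3 * n - 1) / 3 + j / 2) % 2 = 1 := hc
      rw [key hm, two_mod, parityCoeff_of_odd (by omega)]
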